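/- Let $M$ be a loopless oriented matroid on a finite ground set $E$, given by its covectors $\mathcal L(M)\subseteq\{0,+,-\}^E$. Its topes are its maximal covectors, and they form the set $\mathcal T(M)\subseteq\{+,-\}^E$. Its flats are the zero sets of covectors. For a flag of flats $\mathcal F:\emptyset=F_0\subsetneq F_1\subsetneq\dots\subsetneq F_t=E$ (not necessarily complete), let $M_{\mathcal F}=\bigoplus_{i=0}^{t-1}M|_{F_{i+1}}/F_i$ be the initial oriented matroid, again a loopless oriented matroid on $E$. For a loopless oriented matroid $N$ on $E$ and an integer $p\ge 0$: * $\mathcal P^{p}(N)$ is the group of functions $\mathcal T(N)\to\mathbb Z$ that are represented by a polynomial with integer coefficients of degree at most $p$ in the Heaviside functions $h_e$ ($e\in E$), where $h_e(T)=1$ if $T_e=+$ and $h_e(T)=0$ if $T_e=-$; $\mathcal P^{-1}(N)=0$. The dual Varchenko–Gelfand filtration is given by $$\mathcal P_p(N)=\Big\{\textstyle\sum_T c_T T\in\mathbb Z[\mathcal T(N)] : \sum_T c_T f(T)=0\text{ for all } f\in\mathcal P^{p-1}(N)\Big\}\subseteq\mathbb Z[\{0,+,-\}^E].$$ * The Cordovil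 algebra $\mathcal A^\bullet(N)$ is the quotient of $\mathbb Z[x^*_e:e\in E]$ by the ideal generated by all $(x_e^*)^2$ and all $\sum_{k=1}^m C(i_k)\,x^*_{i_1}\cdots\widehat{x^*_{i_k}}\cdots x^*_{i_m}$, where $C$ is a signed circuit of $N$ with support $\{i_1,\dots,i_m\}$. Let $\mathrm{SFSym}(E)=\mathbb Z[x_e:e\in E]/\langle x_e^2\rangle$, paired with $\mathbb Z[x_e^*]/\langle (x_e^*)^2\rangle$ by $\langle (x^*)^S,x^T\rangle=\delta_{S,T}$. Then $\mathcal A_p(N)\subseteq\mathrm{SFSym}(E)$, the degree $p$ part of the graded dual of $\mathcal A^\bullet(N)$, is the group of homogeneous elements of degree $p$ that pair to zero with the defining ideal of $\mathcal A^\bullet(N)$. * Let $\mathcal G:\emptyset=G_0\subsetneq\dots\subsetneq G_d=E$ be a complete (i.e. maximal) flag of flats of $N$, let $p\le d$, and let $T$ be a tope of $N$ such that for every $i$ the sign vector obtained from $T$ by setting the coordinates in $G_i$ to $0$ is a covector. Put $\gamma_{\mathcal G,T,p}=\sum_{A\subseteq\{1,\dots,p\}}(-1)^{|A|}\,T^{A}$,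 where $T^{A}$ arises from $T$ by changing the signs on $G_i\setminus G_{i-1}$ for all $i\in A$, and $\epsilon_{\mathcal G,T,p}=\prod_{i=1}^p\big(\sum_{j\in G_i\setminus G_{i-1}}T_j x_j\big)\in\mathrm{SFSym}(E)$. Write $\tilde a_p:\mathcal P_p(N)\to\mathcal A_p(N)$ for the $\mathbb Z$-linear map with $\tilde a_p(\gamma_{\mathcal G,T,p})=\epsilon_{\mathcal G,T,p}$ for all such $(\mathcal G,T)$. **Theorem.** Let $\mathcal F\subseteq\mathcal F'$ be flags of flats of $M$ as above, and let $(N',N)$ be either $(M_{\mathcal F'},M_{\mathcal F})$ or $(M_{\mathcal F},M)$. Then for every $p\ge0$ the maps $\tilde a_p$ of $N'$ and of $N$ exist and are unique, one has $\mathcal P_p(N')\subseteq\mathcal P_p(N)$ and $\mathcal A_p(N')\subseteq\mathcal A_p(N)$, and the diagram $$\begin{array}{ccccccccc} 0&\to&\mathcal P_{p+1}(N')&\hookrightarrow&\mathcal P_p(N')&\xrightarrow{\ \tilde a_p\ }&\mathcal A_p(N')&\to&0\\ &&\downarrow&&\downarrow&&\downarrow&&\\ 0&\to&\mathcal P_{p+1}(N)&\hookrightarrow&\mathcal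 P_p(N)&\xrightarrow{\ \tilde a_p\ }&\mathcal A_p(N)&\to&0 \end{array}$$ whose vertical maps are the inclusions (within $\mathbb Z[\{0,+,-\}^E]$ and within $\mathrm{SFSym}(E)$, respectively) has exact rows and commutes. -/

import Mathlib

/-- The composition `X ∘ Y` of two sign vectors. -/
def signComp {E : Type*} (X Y : E → SignType) : E → SignType :=
  fun e => if X e = 0 then Y e else X e

/-- The separation set of two sign vectors: the positions in which they have opposite
nonzero signs. -/
def signSep {E : Type*} (X Y : E → SignType) : Set E :=
  {e | X e ≠ 0 ∧ Y e = -X e}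

/-- The coordinatewise partial order on sign vectors induced by `0 < +` and `0 < -`. -/
def signLE {E : Type*} (X Y : E → SignType) : Prop :=
  ∀ e, X e = 0 ∨ X e = Y e

/-- Orthogonality of sign vectors: either the supports are disjoint, or the two vectors agree
in sign at some common support element and disagree at another one. -/
def signOrthogonal {E : Type*} (X Y : E → SignType) : Prop :=
  (∀ e, X e * Y e = 0) ∨ ((∃ e, X e * Y e = 1) ∧ ∃ f, X f * Y f = -1)

/-- An oriented matroid on the ground set `E`, given by its covectors. -/
@[ext]
structure OrientedMatroid (E : Type*) where
  covectors : Set (E → SignType)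
  zero_mem : (fun _ => 0) ∈ covectors
  neg_mem : ∀ X ∈ covectors, (fun e => -X e) ∈ covectors
  comp_mem : ∀ X ∈ covectors, ∀ Y ∈ covectors, signComp X Y ∈ covectors
  elimination : ∀ X ∈ covectors, ∀ Y ∈ covectors, ∀ e ∈ signSep X Y,
    ∃ Z ∈ covectors, Z e = 0 ∧ ∀ f, f ∉ signSep X Y → Z f = signComp X Y f

namespace OrientedMatroid

/-- The topes: the maximal covectors. -/
def topes {E : Type*} (M : OrientedMatroid E) : Set (E → SignType) :=
  {T | T ∈ M.covectors ∧ ∀ X ∈ M.covectors, signLE T X → X = T}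

/-- No element of the ground set is a loop, that is, none is zero in all covectors. -/
def Loopless {E : Type*} (M : OrientedMatroid E) : Prop :=
  ∀ e, ∃ X ∈ M.covectors, X e ≠ 0

/-- The flats of the underlying matroid: the zero sets of covectors. -/
def IsFlat {E : Type*} (M : OrientedMatroid E) (F : Set E) : Prop :=
  ∃ X ∈ M.covectors, F = {e | X e = 0}

/-- A vector of `M`: a sign vector orthogonal to all covectors. -/
def IsVector {E : Type*} (M : OrientedMatroid E) (V : E → SignType) : Prop :=
  ∀ X ∈ M.covectors, signOrthogonal V X

/-- The signed circuits of `M`: the nonzero vectors of minimal support. -/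
def IsSignedCircuit {E : Type*} (M : OrientedMatroid E) (C : E → SignType) : Prop :=
  M.IsVector C ∧ (∃ e, C e ≠ 0) ∧
    ∀ V, M.IsVector V → (∃ e, V e ≠ 0) → (∀ e, V e ≠ 0 → C e ≠ 0) → ∀ e, C e ≠ 0 → V e ≠ 0

/-! ### Minors, direct sums and initial oriented matroids -/

/-- The restriction `M|S`, on the ground set `S`. -/
def restrict {E : Type*} (M : OrientedMatroid E) (S : Set E) : OrientedMatroid S where
  covectors := {X | ∃ Y ∈ M.covectors, X = fun e : S => Y e}
  zero_mem := ⟨_, M.zero_mem, rfl⟩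
  neg_mem := by
    rintro _ ⟨Y, hY, rfl⟩
    exact ⟨_, M.neg_mem Y hY, rfl⟩
  comp_mem := by
    rintro _ ⟨X, hX, rfl⟩ _ ⟨Y, hY, rfl⟩
    exact ⟨_, M.comp_mem X hX Y hY, rfl⟩
  elimination := by
    rintro _ ⟨X, hX, rfl⟩ _ ⟨Y, hY, rfl⟩ e he
    obtain ⟨Z, hZ, hZe, hZf⟩ := M.elimination X hX Y hY e he
    exact ⟨_, ⟨Z, hZ, rfl⟩, hZe, fun f hf => hZf f hf⟩

/-- The contraction `M/S`, on the ground set `E ∖ S`. -/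
def contract {E : Type*} (M : OrientedMatroid E) (S : Set E) :
    OrientedMatroid (Sᶜ : Set E) where
  covectors := {X | ∃ Y ∈ M.covectors, (∀ e ∈ S, Y e = 0) ∧ X = fun e : (Sᶜ : Set E) => Y e}
  zero_mem := ⟨_, M.zero_mem, fun _ _ => rfl, rfl⟩
  neg_mem := by
    rintro _ ⟨Y, hY, hS, rfl⟩
    exact ⟨_, M.neg_mem Y hY, fun e he => by simp [hS e he], rfl⟩
  comp_mem := by
    rintro _ ⟨X, hX, hXS, rfl⟩ _ ⟨Y, hY, hYS, rfl⟩
    exact ⟨_, M.comp_mem X hX Y hY, fun e he => by simp [signComp, hXS e he, hYS e he], rfl⟩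
  elimination := by
    rintro _ ⟨X, hX, hXS, rfl⟩ _ ⟨Y, hY, hYS, rfl⟩ e he
    obtain ⟨Z, hZ, hZe, hZf⟩ := M.elimination X hX Y hY e he
    refine ⟨_, ⟨Z, hZ, fun f hf => ?_, rfl⟩, hZe, fun f hf => hZf f hf⟩
    rw [hZf f (fun h => h.1 (hXS f hf))]
    simp [signComp, hXS f hf, hYS f hf]

/-- The direct sum of a family of oriented matroids, on the disjoint union of the ground sets. -/
def directSum {ι : Type*} {B : ι → Type*} (N : ∀ i, OrientedMatroid (B i)) :
    OrientedMatroid (Σ i, B i) where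
  covectors := {X | ∀ i, (fun b : B i => X ⟨i, b⟩) ∈ (N i).covectors}
  zero_mem := fun i => (N i).zero_mem
  neg_mem := fun _ hX i => (N i).neg_mem _ (hX i)
  comp_mem := fun _ hX _ hY i => (N i).comp_mem _ (hX i) _ (hY i)
  elimination := by
    classical
    rintro X hX Y hY ⟨i, b⟩ he
    obtain ⟨Z, hZ, hZe, hZf⟩ := (N i).elimination _ (hX i) _ (hY i) b he
    refine ⟨fun x => if h : x.1 = i then Z (h ▸ x.2) else signComp X Y x, fun j => ?_, ?_, ?_⟩
    · by_cases hj : j = i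
      · subst hj
        simpa using hZ
      · simp only [hj, dite_false]
        exact (N j).comp_mem _ (hX j) _ (hY j)
    · simpa using hZe
    · rintro ⟨j, c⟩ hf
      by_cases hj : j = i
      · subst hj
        simp only [dite_true]
        exact hZf c hf
      · simp [hj]

/-- Transport of an oriented matroid along a bijection of ground sets. -/
def relabel {E E' : Type*} (M : OrientedMatroid E) (φ : E ≃ E') : OrientedMatroid E' where
  covectors := {X | (fun e => X (φ e)) ∈ M.covectors}
  zero_mem := M.zero_mem
  neg_mem := fun _ hX => M.neg_mem _ hX
  comp_mem := fun _ hX _ hY => M.comp_mem _ hX _ hY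
  elimination := by
    intro X hX Y hY e he
    obtain ⟨Z, hZ, hZe, hZf⟩ := M.elimination _ hX _ hY (φ.symm e)
      (by simpa [signSep] using he)
    refine ⟨fun e => Z (φ.symm e), by simpa using hZ, hZe, fun f hf => ?_⟩
    have h := hZf (φ.symm f) (by simpa [signSep] using hf)
    simpa [signComp] using h

/-- A flag of flats `∅ = F₀ < F₁ < ⋯ < F_t = E` of `M`, not necessarily complete;
`t` is the field `length`. -/
structure FlatFlag {E : Type*} (M : OrientedMatroid E) where
  length : ℕ
  flat : Fin (length + 1) → Set E
  isFlat : ∀ i, M.IsFlat (flat i)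
  strictMono : StrictMono flat
  flat_first : flat 0 = ∅
  flat_last : flat (Fin.last length) = Set.univ

namespace FlatFlag

/-- The successive differences `F_{i+1} ∖ F_i`, for `i = 0, …, t - 1`. -/
def block {E : Type*} {M : OrientedMatroid E} (F : M.FlatFlag) (i : Fin F.length) : Set E :=
  F.flat i.succ \ F.flat i.castSucc

/-- A flag is complete if no flat lies strictly between two consecutive members. -/
def IsComplete {E : Type*} {M : OrientedMatroid E} (F : M.FlatFlag) : Prop :=
  ∀ (i : Fin F.length) (G : Set E), M.IsFlat G → F.flat i.castSucc ⊂ G →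
    G ⊆ F.flat i.succ → G = F.flat i.succ

/-- The minor `M|F_{i+1} / F_i`. -/
def minor {E : Type*} {M : OrientedMatroid E} (F : M.FlatFlag) (i : Fin F.length) :
    OrientedMatroid ((Subtype.val ⁻¹' F.flat i.castSucc : Set (F.flat i.succ))ᶜ : Set _) :=
  (M.restrict (F.flat i.succ)).contract (Subtype.val ⁻¹' F.flat i.castSucc)

theorem block_bijective {E : Type*} {M : OrientedMatroid E} (F : M.FlatFlag) :
    Function.Bijective (fun x : (Σ i : Fin F.length,
      ((Subtype.val ⁻¹' F.flat i.castSucc : Set (F.flat i.succ))ᶜ : Set _)) =>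
        ((x.2 : F.flat x.1.succ) : E)) := by
  constructor
  · have key : ∀ i j : Fin F.length, i < j → ∀ e, e ∈ F.flat i.succ →
        e ∉ F.flat j.castSucc → False := by
      intro i j hij e he he'
      exact he' (F.strictMono.monotone (Fin.succ_le_castSucc_iff.2 hij) he)
    rintro ⟨i, ⟨⟨e, he⟩, he'⟩⟩ ⟨j, ⟨⟨f, hf⟩, hf'⟩⟩ h
    have h : e = f := h
    subst h
    rcases lt_trichotomy i j with hij | hij | hij
    · exact (key i j hij e he hf').elim
    · subst hij
      rfl
    · exact (key j i hij e hf he').elim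
  · intro e
    classical
    have hex : ∃ n, ∃ h : n < F.length + 1, e ∈ F.flat ⟨n, h⟩ :=
      ⟨F.length, Nat.lt_succ_self _, by
        have := F.flat_last
        rw [show (⟨F.length, Nat.lt_succ_self _⟩ : Fin (F.length + 1)) = Fin.last _ from rfl,
          this]
        trivial⟩
    obtain ⟨hlt, hmem⟩ := Nat.find_spec hex
    have hmin := fun m => Nat.find_min hex (m := m)
    generalize Nat.find hex = n at hlt hmem hmin
    cases n with
    | zero =>
      have : e ∈ F.flat 0 := hmem
      rw [F.flat_first] at this
      exact this.elim
    | succ m =>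
      exact ⟨⟨⟨m, by omega⟩, ⟨⟨e, hmem⟩, fun h => hmin m (by omega) ⟨by omega, h⟩⟩⟩, rfl⟩

/-- The disjoint union of the ground sets of the minors `M|F_{i+1} / F_i` is `E`. -/
noncomputable def blockEquiv {E : Type*} {M : OrientedMatroid E} (F : M.FlatFlag) :
    (Σ i : Fin F.length,
      ((Subtype.val ⁻¹' F.flat i.castSucc : Set (F.flat i.succ))ᶜ : Set _)) ≃ E :=
  Equiv.ofBijective _ F.block_bijective

end FlatFlag

/-- The initial oriented matroid `M_F = ⨁ M|F_{i+1} / F_i`, on the ground set `E` of `M`. -/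
noncomputable def initialAt {E : Type*} (M : OrientedMatroid E) (F : M.FlatFlag) :
    OrientedMatroid E :=
  (directSum F.minor).relabel F.blockEquiv

/-! ### The Varchenko–Gelfand filtration and its dual -/

/-- The integral tope space `ℤ[𝒯(M)]`, inside the free module on all sign vectors. -/
noncomputable def topeSpace {E : Type*} (M : OrientedMatroid E) :
    Submodule ℤ ((E → SignType) →₀ ℤ) :=
  Finsupp.supported ℤ ℤ M.topes

/-- The Heaviside function `h_e`. The Varchenko–Gelfand ring, the dual of the tope space with
pointwise operations on topes, is the ring of functions `M.topes → ℤ`. -/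
def heaviside {E : Type*} (M : OrientedMatroid E) (e : E) : M.topes → ℤ :=
  fun T => if T.1 e = 1 then 1 else 0

/-- The degree filtration `𝒫^p`: zero, and the functions represented by a polynomial of degree
at most `p` in the Heaviside functions. -/
noncomputable def degreeFiltration {E : Type*} (M : OrientedMatroid E) (p : ℤ) :
    Submodule ℤ (M.topes → ℤ) where
  carrier := {f | f = 0 ∨ ∃ q : MvPolynomial E ℤ,
    (q.totalDegree : ℤ) ≤ p ∧ MvPolynomial.aeval M.heaviside q = f}
  zero_mem' := Or.inl rfl
  add_mem' := by
    rintro _ _ (rfl | ⟨q, hq, rfl⟩) (rfl | ⟨r, hr, rfl⟩)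
    · exact Or.inl (add_zero 0)
    · exact Or.inr ⟨r, hr, by simp⟩
    · exact Or.inr ⟨q, hq, by simp⟩
    · refine Or.inr ⟨q + r, ?_, by simp⟩
      have h1 := MvPolynomial.totalDegree_add q r
      have h2 : ((max q.totalDegree r.totalDegree : ℕ) : ℤ) ≤ p := by
        rw [Nat.cast_max]
        exact max_le hq hr
      exact le_trans (by exact_mod_cast h1) h2
  smul_mem' := by
    rintro c _ (rfl | ⟨q, hq, rfl⟩)
    · exact Or.inl (smul_zero c)
    · refine Or.inr ⟨c • q, le_trans ?_ hq, by simp⟩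
      exact_mod_cast MvPolynomial.totalDegree_smul_le c q

/-- The evaluation pairing `(f, γ) ↦ f(γ) = ∑_T γ_T f(T)`, the sum being over the topes. -/
noncomputable def evalPairing {E : Type*} (M : OrientedMatroid E) (f : M.topes → ℤ) :
    ((E → SignType) →₀ ℤ) →ₗ[ℤ] ℤ :=
  Finsupp.linearCombination ℤ f ∘ₗ Finsupp.lsubtypeDomain M.topes

/-- The dual degree filtration: `𝒫_p(M) ⊆ ℤ[𝒯(M)]` is the annihilator of `𝒫^{p-1}(M)`. -/
noncomputable def dualFiltration {E : Type*} (M : OrientedMatroid E) (p : ℕ) :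
    Submodule ℤ ((E → SignType) →₀ ℤ) :=
  M.topeSpace ⊓ ⨅ f ∈ M.degreeFiltration ((p : ℤ) - 1), LinearMap.ker (M.evalPairing f)

end OrientedMatroid

/-! ### The dual Cordovil algebra -/

/-- `ℤ[x_e : e ∈ E] / ⟨x_e² : e ∈ E⟩`. -/
abbrev SFSym (E : Type*) : Type _ :=
  MvPolynomial E ℤ ⧸ Ideal.span (Set.range fun e : E => (MvPolynomial.X e : MvPolynomial E ℤ) ^ 2)

/-- The exponent vector of the square-free monomial `x^S`. -/
noncomputable def squarefreeExponent {E : Type*} (S : Finset E) : E →₀ ℕ :=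
  ∑ e ∈ S, Finsupp.single e 1

theorem squarefreeExponent_le_one {E : Type*} (S : Finset E) (e : E) :
    squarefreeExponent S e ≤ 1 := by
  classical
  simp only [squarefreeExponent, Finsupp.finsetSum_apply, Finsupp.single_apply,
    Finset.sum_ite_eq']
  split_ifs <;> simp

theorem coeff_squarefreeExponent_eq_zero {E : Type*} (S : Finset E) (q : MvPolynomial E ℤ)
    (hq : q ∈ Ideal.span (Set.range fun e : E => (MvPolynomial.X e : MvPolynomial E ℤ) ^ 2)) :
    MvPolynomial.coeff (squarefreeExponent S) q = 0 := by
  rw [show (fun e : E => (MvPolynomial.X e : MvPolynomial E ℤ) ^ 2) =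
    fun e => MvPolynomial.monomial (Finsupp.single e 2) 1 from
      funext fun e => MvPolynomial.X_pow_eq_monomial] at hq
  by_contra hne
  obtain ⟨_, ⟨e, rfl⟩, hle⟩ := (MvPolynomial.mem_ideal_span_monomial_image
    (s := Set.range fun e : E => Finsupp.single e 2) (x := q)).1
      (by rwa [← Set.range_comp]) _ (MvPolynomial.mem_support_iff.2 hne)
  have h1 := hle e
  have h2 := squarefreeExponent_le_one S e
  simp only [Finsupp.single_eq_same] at h1
  omega

/-- The coefficient of `x^S` in an element of `SFSym E`. -/
noncomputable def sfCoeff {E : Type*} (S : Finset E) : SFSym E →+ ℤ :=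
  QuotientAddGroup.lift _ (MvPolynomial.coeffAddMonoidHom (squarefreeExponent S))
    (fun q hq => coeff_squarefreeExponent_eq_zero S q hq)

/-- The pairing of `ℤ[x_e^*]/⟨(x_e^*)²⟩` with `ℤ[x_e]/⟨x_e²⟩` given by
`⟨(x^*)^S, x^T⟩ = δ_{S,T}`. -/
noncomputable def sfPairing {E : Type*} [Fintype E] (f g : SFSym E) : ℤ :=
  ∑ S : Finset E, sfCoeff S f * sfCoeff S g

namespace OrientedMatroid

open Classical in
/-- The element `∑_k C(i_k) x_{i_1} ⋯ x̂_{i_k} ⋯ x_{i_t}` attached to a sign vector `C` with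
support `{i_1, …, i_t}`. -/
noncomputable def circuitRelation {E : Type*} [Fintype E] (C : E → SignType) :
    MvPolynomial E ℤ :=
  ∑ k : E, MvPolynomial.C ((C k : SignType) : ℤ) *
    ∏ j ∈ Finset.univ.filter (fun j => C j ≠ 0 ∧ j ≠ k), MvPolynomial.X j

/-- The ideal whose quotient `ℤ[x_e^* : e ∈ E] / M.cordovilIdeal` is the Cordovil algebra
`𝒜^•(M; ℤ)`. -/
noncomputable def cordovilIdeal {E : Type*} [Fintype E] (M : OrientedMatroid E) :
    Ideal (MvPolynomial E ℤ) :=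
  Ideal.span (Set.range fun e : E => (MvPolynomial.X e : MvPolynomial E ℤ) ^ 2) ⊔
    Ideal.span {r | ∃ C, M.IsSignedCircuit C ∧ r = circuitRelation C}

/-- The degree `p` part `𝒜_p(M; ℤ)` of the graded dual of the Cordovil algebra, inside `SFSym E`:
the homogeneous elements of degree `p` that pair to zero with the defining ideal. -/
noncomputable def dualCordovil {E : Type*} [Fintype E] (M : OrientedMatroid E) (p : ℕ) :
    Submodule ℤ (SFSym E) where
  carrier := {a | (∀ S : Finset E, S.card ≠ p → sfCoeff S a = 0) ∧
    ∀ r ∈ M.cordovilIdeal, sfPairing (Ideal.Quotient.mk _ r) a = 0}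
  zero_mem' := by simp [sfPairing]
  add_mem' := by
    rintro a b ⟨ha, ha'⟩ ⟨hb, hb'⟩
    refine ⟨fun S hS => by rw [map_add, ha S hS, hb S hS, add_zero], fun r hr => ?_⟩
    have h1 := ha' r hr
    have h2 := hb' r hr
    simp only [sfPairing] at h1 h2 ⊢
    simp only [map_add, mul_add, Finset.sum_add_distrib, h1, h2, add_zero]
  smul_mem' := by
    rintro c a ⟨ha, ha'⟩
    refine ⟨fun S hS => by rw [map_zsmul, ha S hS, smul_zero], fun r hr => ?_⟩
    have h1 := ha' r hr
    simp only [sfPairing] at h1 ⊢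
    simp only [map_zsmul, mul_smul_comm, ← Finset.smul_sum, h1, smul_zero]

/-! ### Prefix chains and the maps `ã_p` -/

open Classical in
/-- The topes `T` of `M` such that, for all members `F_i` of the flag, setting the coordinates of
`T` in `F_i` to zero yields a covector. -/
noncomputable def flagTopes {E : Type*} (M : OrientedMatroid E) (F : M.FlatFlag) :
    Set (E → SignType) :=
  {T | T ∈ M.topes ∧ ∀ i, (fun e => if e ∈ F.flat i then 0 else T e) ∈ M.covectors}

open Classical in
/-- The sign vector obtained from `T` by changing the signs on the blocks
`F_{i+1} ∖ F_i` with `i ∈ A`. -/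
noncomputable def flipBlocks {E : Type*} {M : OrientedMatroid E} (F : M.FlatFlag)
    (T : E → SignType) (A : Finset (Fin F.length)) : E → SignType :=
  fun e => if ∃ i ∈ A, e ∈ F.block i then -T e else T e

/-- The `p`-th prefix chain `γ_{F,T,p}`: the sum of the sign vectors arising from `T` by changing
signs on an arbitrary set `A` of blocks among the first `p`, with coefficients `(-1)^|A|`. -/
noncomputable def prefixChain {E : Type*} {M : OrientedMatroid E} (F : M.FlatFlag)
    (T : E → SignType) (p : ℕ) : (E → SignType) →₀ ℤ :=
  ∑ A ∈ (Finset.univ.filter (fun i : Fin F.length => (i : ℕ) < p)).powerset,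
    Finsupp.single (flipBlocks F T A) ((-1) ^ A.card)

open Classical in
/-- The element `ε_{F,T,p} = ∏_{i=1}^{p} ∑_{j ∈ F_i ∖ F_{i-1}} T(j) x_j` of `SFSym E`. -/
noncomputable def prefixElement {E : Type*} [Fintype E] {M : OrientedMatroid E} (F : M.FlatFlag)
    (T : E → SignType) (p : ℕ) : SFSym E :=
  ∏ i ∈ Finset.univ.filter (fun i : Fin F.length => (i : ℕ) < p),
    ∑ j ∈ Finset.univ.filter (fun j => j ∈ F.block i),
      ((T j : SignType) : ℤ) • (Ideal.Quotient.mk _ (MvPolynomial.X j) : SFSym E)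

/-- The defining property of `ã_p : 𝒫_p(M) → 𝒜_p(M)`: it is linear, and sends `γ_{F,T,p}` to
`ε_{F,T,p}` for every complete flag `F` of length at least `p` and every tope `T ∈ 𝒯_F`. -/
def IsPrefixMap {E : Type*} [Fintype E] (M : OrientedMatroid E) (p : ℕ)
    (a : M.dualFiltration p →ₗ[ℤ] M.dualCordovil p) : Prop :=
  ∀ F : M.FlatFlag, F.IsComplete → p ≤ F.length → ∀ T ∈ M.flagTopes F,
    ∃ h : prefixChain F T p ∈ M.dualFiltration p,
      (a ⟨prefixChain F T p, h⟩ : SFSym E) = prefixElement F T p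

/-- The sequence `0 → 𝒫_{p+1}(M) → 𝒫_p(M) → 𝒜_p(M) → 0`, with the inclusion as first map and
`a` as second map, makes sense and is exact. -/
def IsExactRow {E : Type*} [Fintype E] (M : OrientedMatroid E) (p : ℕ)
    (a : M.dualFiltration p →ₗ[ℤ] M.dualCordovil p) : Prop :=
  M.dualFiltration (p + 1) ≤ M.dualFiltration p ∧
    (∀ γ : M.dualFiltration p,
      a γ = 0 ↔ (γ : (E → SignType) →₀ ℤ) ∈ M.dualFiltration (p + 1)) ∧
    Function.Surjective a

/-- For two oriented matroids `N'`, `N` on `E`: the inclusions `𝒫_q(N') ⊆ 𝒫_q(N)` for all `q`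
and `𝒜_p(N') ⊆ 𝒜_p(N)` hold, the maps `ã_p` of `N'` and `N` exist and are unique, and the diagram
with rows `0 → 𝒫_{p+1} → 𝒫_p → 𝒜_p → 0` and with the inclusions as vertical maps has exact rows
and commutes. -/
def FiltrationDiagram {E : Type*} [Fintype E] (N' N : OrientedMatroid E) (p : ℕ) : Prop :=
  ∃ (hP : ∀ q, N'.dualFiltration q ≤ N.dualFiltration q)
    (hA : N'.dualCordovil p ≤ N.dualCordovil p)
    (a' : N'.dualFiltration p →ₗ[ℤ] N'.dualCordovil p)
    (a : N.dualFiltration p →ₗ[ℤ] N.dualCordovil p),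
    (N'.IsPrefixMap p a' ∧ ∀ b, N'.IsPrefixMap p b → b = a') ∧
    (N.IsPrefixMap p a ∧ ∀ b, N.IsPrefixMap p b → b = a) ∧
    N'.IsExactRow p a' ∧ N.IsExactRow p a ∧
    Submodule.inclusion hA ∘ₗ a' = a ∘ₗ Submodule.inclusion (hP p)

end OrientedMatroid

/-!
For a finite set `S ⊆ E` and a chain `γ` of sign vectors let `⟨h^S, γ⟩` be the value of `γ` on
the monomial `∏_{e ∈ S} h_e` in the Heaviside functions. An integral chain of topes lies in `𝒫_p`
if and only if `⟨h^S, γ⟩ = 0` for all `|S| < p` (`mem_dualFiltration_iff`), and the map `ã_p` is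
`γ ↦ ∑_{|S| = p} ⟨h^S, γ⟩ x^S` (`symbolMap`). With this description the kernel of `ã_p` is
visibly `𝒫_{p+1}`, and the formula does not mention the oriented matroid, so it commutes with
inclusions of tope sets.

The image of `ã_p` lies in `𝒜_p` (`topCoeff_mem_dualCoeff`): a tope never has the signs
prescribed by a signed circuit `C`, so `∏_{C_j = +} h_j ∏_{C_j = -} (1 - h_j)` vanishes on topes,
and so does the same product for `-C`. Comparing the top degrees of the two expansions gives the
relations of the Cordovil algebra. A product computation over the blocks of a flag
(`heavisidePairing_flagChain`) shows that `γ_{F,T,p}` lies in `𝒫_p` and is mapped to `ε_{F,T,p}`.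

The main point is that the elements `ε_{F,T,p}` span `𝒜_p` over `ℤ` (`mem_flagSpan`). The
relations are homogeneous for the grading of square-free monomials by their closure, so only
elements `a = ∑_S a_S x^S` whose sets `S` have a fixed closure `G` need to be considered. Fix
`e ∈ G`. Contraction by `x_e` gives an element of degree `p - 1`, which is by induction a
combination of flag elements ending in flats `H` that `G` covers and that do not contain `e`.
Multiplying the part belonging to `H` by the linear form `∑_{j ∈ G ∖ H} Y_j x_j` of a covector `Y`
with zero set `H`, and by the sign `Y_e`, gives a combination of flag elements that agrees with `a`
on all `S ∋ e`. Finally, fundamental circuits (`exists_isSignedCircuit`) show that an element of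
`𝒜_p` of this kind is determined by its coefficients at the sets `S ∋ e`.

Hence `ã_p` is surjective, and by descending induction on `p` the chains `γ_{F,T,p}` span `𝒫_p`
(`dualFiltration_eq_prefixSpan`), which gives uniqueness. For the vertical maps only the
inclusion of topes is needed (`filtrationDiagram_of_topes_subset`), and the topes of `M_F` are the
topes `T` of `M` such that zeroing `T` on each member of `F` gives a covector
(`topes_initialAt`).
-/

namespace OrientedMatroid

/-! ### Closure, flats and signed circuits -/

section Closure

variable {E : Type*} (M : OrientedMatroid E)

/-- The closure of `A` in the underlying matroid: the elements at which every covector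
vanishing on `A` vanishes. -/
def cl (A : Set E) : Set E :=
  {e | ∀ X ∈ M.covectors, (∀ a ∈ A, X a = 0) → X e = 0}

variable {M}

theorem subset_cl (A : Set E) : A ⊆ M.cl A := fun _ ha _ _ h => h _ ha

theorem cl_subset_cl {A B : Set E} (h : A ⊆ M.cl B) : M.cl A ⊆ M.cl B :=
  fun _ he X hX hB => he X hX fun _ ha => h ha X hX hB

theorem cl_mono {A B : Set E} (h : A ⊆ B) : M.cl A ⊆ M.cl B :=
  cl_subset_cl (h.trans (subset_cl B))

theorem cl_cl (A : Set E) : M.cl (M.cl A) = M.cl A :=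
  (cl_subset_cl subset_rfl).antisymm (subset_cl _)

theorem signComp_eq_zero {X Y : E → SignType} {e : E} :
    signComp X Y e = 0 ↔ X e = 0 ∧ Y e = 0 := by
  unfold signComp
  split_ifs with h <;> simp [h]

theorem exists_covector_zeroSet_eq_cl [Finite E] (A : Set E) :
    ∃ X ∈ M.covectors, ∀ e, X e = 0 ↔ e ∈ M.cl A := by
  classical
  have hne : ∃ n, ∃ X ∈ M.covectors, (∀ a ∈ A, X a = 0) ∧ {e | X e = 0}.ncard = n :=
    ⟨_, _, M.zero_mem, fun _ _ => rfl, rfl⟩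
  obtain ⟨X, hX, hXA, hXn⟩ := Nat.find_spec hne
  refine ⟨X, hX, fun e => ⟨fun h0 => ?_, fun h => h X hX hXA⟩⟩
  by_contra he
  simp only [cl, Set.mem_ofPred_eq, not_forall] at he
  obtain ⟨Y, hY, hYA, hYe⟩ := he
  refine Nat.find_min hne (m := {f | signComp X Y f = 0}.ncard) ?_
    ⟨_, M.comp_mem X hX Y hY, fun a ha => signComp_eq_zero.2 ⟨hXA a ha, hYA a ha⟩, rfl⟩
  rw [← hXn]
  refine Set.ncard_lt_ncard ⟨fun f hf => (signComp_eq_zero.1 hf).1, fun h => hYe ?_⟩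
    (Set.toFinite _)
  exact (signComp_eq_zero.1 (h h0)).2

theorem isFlat_cl [Finite E] (A : Set E) : M.IsFlat (M.cl A) := by
  obtain ⟨X, hX, h⟩ := M.exists_covector_zeroSet_eq_cl A
  exact ⟨X, hX, by ext e; exact (h e).symm⟩

theorem IsFlat.cl_eq {F : Set E} (hF : M.IsFlat F) : M.cl F = F := by
  obtain ⟨X, hX, rfl⟩ := hF
  exact Set.Subset.antisymm (fun e he => he X hX fun _ h => h) (subset_cl _)

theorem IsFlat.cl_subset {F A : Set E} (hF : M.IsFlat F) (h : A ⊆ F) : M.cl A ⊆ F :=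
  hF.cl_eq ▸ cl_mono h

/-- The exchange property of the closure. It is the elimination axiom applied at `f`. -/
theorem cl_exchange {A : Set E} {e f : E} (he : e ∈ M.cl (insert f A)) (he' : e ∉ M.cl A) :
    f ∈ M.cl (insert e A) := by
  by_contra hf
  simp only [cl, Set.mem_ofPred_eq, not_forall] at hf he'
  obtain ⟨X, hX, hXA, hXf⟩ := hf
  obtain ⟨Y, hY, hYA, hYe⟩ := he'
  have hXe : X e = 0 := hXA e (Set.mem_insert _ _)
  have hYf : Y f ≠ 0 := fun h => hYe <| he Y hY <| by
    rintro a (rfl | ha)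
    exacts [h, hYA a ha]
  obtain ⟨X', hX', hX'0, hXY⟩ : ∃ X' ∈ M.covectors, (∀ a, X a = 0 → X' a = 0) ∧
      X' f ≠ 0 ∧ Y f = -X' f := by
    have : Y f = -X f ∨ Y f = X f := by
      revert hXf hYf; generalize X f = x; generalize Y f = y; revert x y; decide
    rcases this with h | h
    · exact ⟨X, hX, fun _ h => h, hXf, h⟩
    · exact ⟨_, M.neg_mem X hX, fun a h => by simp [h], by simpa using hXf, by simp [h]⟩
  obtain ⟨Z, hZ, hZf, hZ'⟩ := M.elimination X' hX' Y hY f hXY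
  have hsep : ∀ a, X a = 0 → Z a = Y a := fun a ha => by
    rw [hZ' a fun h => h.1 (hX'0 a ha)]
    simp [signComp, hX'0 a ha]
  refine hYe ((hsep e hXe).symm.trans (he Z hZ ?_))
  rintro a (rfl | ha)
  · exact hZf
  · rw [hsep a (hXA a (Set.mem_insert_of_mem _ ha)), hYA a ha]

/-- Independence in the underlying matroid. -/
def Indep (M : OrientedMatroid E) (S : Set E) : Prop :=
  ∀ s ∈ S, s ∉ M.cl (S \ {s})

theorem exists_covector_eq_one {A : Set E} {s : E} (h : s ∉ M.cl A) :
    ∃ X ∈ M.covectors, X s = 1 ∧ ∀ a ∈ A, X a = 0 := by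
  simp only [cl, Set.mem_ofPred_eq, not_forall] at h
  obtain ⟨X, hX, hXA, hXs⟩ := h
  have : X s = 1 ∨ X s = -1 := by
    revert hXs; generalize X s = x; revert x; decide
  rcases this with h | h
  · exact ⟨X, hX, h, hXA⟩
  · exact ⟨_, M.neg_mem X hX, by simp [h], fun a ha => by simp [hXA a ha]⟩

theorem IsVector.mem_cl {C : E → SignType} (hC : M.IsVector C) {k : E} (hk : C k ≠ 0) :
    k ∈ M.cl {j | C j ≠ 0 ∧ j ≠ k} := by
  intro X hX h0
  have key : ∀ j, C j * X j ≠ 0 → j = k := fun j hj => by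
    by_contra hjk
    exact hj (by rw [h0 j ⟨left_ne_zero_of_mul hj, hjk⟩, mul_zero])
  rcases hC X hX with h | ⟨⟨e, he⟩, f, hf⟩
  · exact (mul_eq_zero.1 (h k)).resolve_left hk
  · have h1 := key e (by rw [he]; decide)
    have h2 := key f (by rw [hf]; decide)
    rw [h1] at he
    rw [h2, he] at hf
    exact absurd hf (by decide)

/-- Fundamental circuits. For `s ∈ S` let `X s` be a covector which is positive at `s` and zero
on the rest of `S`; the circuit has value `+` at `e` and value `-X s e` at `s`. -/
theorem exists_isSignedCircuit {S : Finset E} {e : E} (hS : M.Indep (S : Set E)) (heS : e ∉ S)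
    (he : e ∈ M.cl (S : Set E)) :
    ∃ C, M.IsSignedCircuit C ∧ C e ≠ 0 ∧ ∀ f, C f ≠ 0 → f = e ∨ f ∈ S := by
  classical
  have hX : ∀ s ∈ S, ∃ X ∈ M.covectors, X s = 1 ∧ ∀ t ∈ S, t ≠ s → X t = 0 := fun s hs => by
    obtain ⟨X, hX, h1, h2⟩ := exists_covector_eq_one (hS s hs)
    exact ⟨X, hX, h1, fun t ht hts => h2 t ⟨ht, hts⟩⟩
  choose! X hX hX1 hX0 using hX
  set C : E → SignType := fun f => if f = e then 1 else if f ∈ S then -X f e else 0 with hCdef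
  have hCe : C e = 1 := by simp [hCdef]
  have hne : ∀ s ∈ S, s ≠ e := fun s hs h => heS (h ▸ hs)
  have hCs : ∀ s ∈ S, C s = -X s e := fun s hs => by simp [hCdef, hs, hne s hs]
  have hC0 : ∀ f, C f ≠ 0 → f = e ∨ f ∈ S := fun f hf => by
    by_contra! h
    exact hf (by simp [hCdef, h.1, h.2])
  -- The nonzero coordinates of `Y` in `S` are eliminated one by one against `±X s`; this only
  -- makes the value at `e` larger, and it must be zero once `Y` vanishes on `S`.
  have key : ∀ n, ∀ Y ∈ M.covectors, (S.filter (Y · ≠ 0)).card = n → (∀ f, 0 ≤ C f * Y f) →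
      ∀ f, C f * Y f = 0 := by
    intro n
    induction n with
    | zero =>
      intro Y hY hn _ f
      have h0 : ∀ s ∈ S, Y s = 0 := by simpa [Finset.filter_eq_empty_iff] using hn
      by_cases hf : C f = 0
      · rw [hf, zero_mul]
      · rcases hC0 f hf with rfl | hf
        · rw [he Y hY h0, mul_zero]
        · rw [h0 f hf, mul_zero]
    | succ n ih =>
      intro Y hY hn hpos
      obtain ⟨s, hs⟩ : (S.filter (Y · ≠ 0)).Nonempty := Finset.card_pos.1 (by omega)
      obtain ⟨hsS, hYs⟩ := Finset.mem_filter.1 hs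
      obtain ⟨W, hW, hWs, hWe, hW0⟩ : ∃ W ∈ M.covectors, W s = -Y s ∧ W e = C s * Y s ∧
          ∀ t ∈ S, t ≠ s → W t = 0 := by
        have : Y s = 1 ∨ Y s = -1 := by
          revert hYs; generalize Y s = x; revert x; decide
        rcases this with h | h
        · exact ⟨_, M.neg_mem _ (hX s hsS), by simp [h, hX1 s hsS], by simp [h, hCs s hsS],
            fun t ht hts => by simp [hX0 s hsS t ht hts]⟩
        · exact ⟨_, hX s hsS, by simp [h, hX1 s hsS], by simp [h, hCs s hsS],
            fun t ht hts => hX0 s hsS t ht hts⟩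
      have hYe : 0 ≤ Y e := by simpa [hCe] using hpos e
      have hWe' : 0 ≤ W e := hWe ▸ hpos s
      obtain ⟨Z, hZ, hZs, hZ'⟩ := M.elimination Y hY W hW s ⟨hYs, hWs⟩
      have hZt : ∀ t ∈ S, t ≠ s → Z t = Y t := fun t ht hts => by
        have hW0 := hW0 t ht hts
        rw [hZ' t fun h => h.1 (by have := h.2; rw [hW0] at this; simpa using this.symm)]
        simp only [signComp, hW0]
        split_ifs with h <;> simp [h]
      have hZe : Z e = signComp Y W e := hZ' e fun h => by
        have h1 := h.1
        have h2 := h.2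
        revert hYe hWe' h1 h2
        generalize Y e = x; generalize W e = y; revert x y; decide
      have hZe0 : 0 ≤ Z e := by
        rw [hZe]; unfold signComp; split_ifs <;> assumption
      have hfil : S.filter (Z · ≠ 0) = (S.filter (Y · ≠ 0)).erase s := by
        ext t
        simp only [Finset.mem_filter, Finset.mem_erase]
        by_cases hts : t = s
        · subst hts; simp [hZs]
        · constructor
          · rintro ⟨h1, h2⟩; exact ⟨hts, h1, hZt t h1 hts ▸ h2⟩
          · rintro ⟨_, h1, h2⟩; exact ⟨h1, (hZt t h1 hts).symm ▸ h2⟩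
      have hZ0 := ih Z hZ (by rw [hfil, Finset.card_erase_of_mem hs]; omega) fun f => by
        by_cases hf : C f = 0
        · simp [hf]
        · rcases hC0 f hf with rfl | hf
          · simpa [hCe] using hZe0
          · by_cases hfs : f = s
            · subst hfs; simp [hZs]
            · rw [hZt f hf hfs]; exact hpos f
      have hZe1 : signComp Y W e = 0 := by rw [← hZe]; simpa [hCe] using hZ0 e
      obtain ⟨hYe0, hWe0⟩ := signComp_eq_zero.1 hZe1
      intro f
      by_cases hf : C f = 0
      · simp [hf]
      · rcases hC0 f hf with rfl | hf
        · simp [hYe0]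
        · by_cases hfs : f = s
          · subst hfs; rw [← hWe, hWe0]
          · rw [← hZt f hf hfs]; exact hZ0 f
  have hvec : M.IsVector C := by
    intro Y hY
    by_cases h0 : ∀ f, C f * Y f = 0
    · exact Or.inl h0
    refine Or.inr ⟨?_, ?_⟩
    · by_contra! h
      refine h0 fun f => ?_
      have := key _ _ (M.neg_mem Y hY) rfl (fun f => by
        have := h f
        rw [mul_neg]
        revert this; generalize C f * Y f = x; revert x; decide) f
      simpa using this
    · by_contra! h
      refine h0 (key _ Y hY rfl fun f => ?_)
      have := h f
      revert this; generalize C f * Y f = x; revert x; decide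
  refine ⟨C, ⟨hvec, ⟨e, by simp [hCe]⟩, ?_⟩, by simp [hCe], hC0⟩
  -- Orthogonality to `X s`, which has only the coordinates `s` and `e` in common with `C`.
  intro V hV hVne hVC
  have hpair : ∀ s ∈ S, C s ≠ 0 → (V s ≠ 0 ↔ V e ≠ 0) := by
    intro s hs hCs0
    have hXe : X s e ≠ 0 := by simpa [hCs s hs] using hCs0
    have honly : ∀ f, V f * X s f ≠ 0 → f = s ∨ f = e := fun f hf => by
      rcases hC0 f (hVC f (left_ne_zero_of_mul hf)) with h | h
      · exact Or.inr h
      · by_contra! hh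
        exact hf (by rw [hX0 s hs f h hh.1, mul_zero])
    rcases hV _ (hX s hs) with h | ⟨⟨a, ha⟩, b, hb⟩
    · have h1 := h s
      have h2 := h e
      rw [hX1 s hs, mul_one] at h1
      have h3 := (mul_eq_zero.1 h2).resolve_right hXe
      simp [h1, h3]
    · have h1 : V a ≠ 0 := fun h => by rw [h, zero_mul] at ha; exact absurd ha (by decide)
      have h2 : V b ≠ 0 := fun h => by rw [h, zero_mul] at hb; exact absurd hb (by decide)
      have hab : a ≠ b := fun h => by rw [h, hb] at ha; exact absurd ha (by decide)
      rcases honly a (by rw [ha]; decide) with rfl | rfl <;>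
      rcases honly b (by rw [hb]; decide) with rfl | rfl
      · exact absurd rfl hab
      · exact iff_of_true h1 h2
      · exact iff_of_true h2 h1
      · exact absurd rfl hab
  have hVe : V e ≠ 0 := by
    obtain ⟨f, hf⟩ := hVne
    rcases hC0 f (hVC f hf) with rfl | h
    · exact hf
    · exact (hpair f h (hVC f hf)).1 hf
  intro f hf
  rcases hC0 f hf with rfl | h
  · exact hVe
  · exact (hpair f h hf).2 hVe

theorem exists_isSignedCircuit_of_not_indep {S : Finset E} (hS : ¬ M.Indep (S : Set E)) :
    ∃ C, M.IsSignedCircuit C ∧ ∀ f, C f ≠ 0 → f ∈ S := by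
  classical
  simp only [Indep, not_forall, not_not] at hS
  obtain ⟨e, heS, he⟩ := hS
  have hex : ∃ n, ∃ R ⊆ S.erase e, e ∈ M.cl (R : Set E) ∧ R.card = n :=
    ⟨_, S.erase e, subset_rfl, by simpa using he, rfl⟩
  obtain ⟨R, hRS, heR, hRn⟩ := Nat.find_spec hex
  have hind : M.Indep (R : Set E) := by
    intro s hs hcl
    refine Nat.find_min hex (m := (R.erase s).card) ?_
      ⟨R.erase s, (Finset.erase_subset _ _).trans hRS, ?_, rfl⟩
    · rw [← hRn]; exact Finset.card_erase_lt_of_mem hs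
    · refine cl_subset_cl (fun t ht => ?_) heR
      by_cases hts : t = s
      · subst hts; simpa using hcl
      · exact subset_cl _ (by simpa [hts] using ht)
  obtain ⟨C, hC, -, hCR⟩ := exists_isSignedCircuit hind
    (fun h => (Finset.mem_erase.1 (hRS h)).1 rfl) heR
  refine ⟨C, hC, fun f hf => ?_⟩
  rcases hCR f hf with rfl | h
  · exact heS
  · exact (Finset.mem_erase.1 (hRS h)).2

end Closure

/-! ### Topes of initial oriented matroids -/

section Topes

variable {E : Type*} {M : OrientedMatroid E}

/-- In a loopless oriented matroid the topes are the covectors without zeros. -/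
theorem Loopless.mem_topes_iff (hM : M.Loopless) {T : E → SignType} :
    T ∈ M.topes ↔ T ∈ M.covectors ∧ ∀ e, T e ≠ 0 := by
  constructor
  · rintro ⟨hT, hmax⟩
    refine ⟨hT, fun e he => ?_⟩
    obtain ⟨X, hX, hXe⟩ := hM e
    have h := hmax _ (M.comp_mem T hT X hX) fun f => by
      by_cases hf : T f = 0 <;> simp [signComp, hf]
    have := congrFun h e
    simp only [signComp, he, if_true] at this
    exact hXe this
  · rintro ⟨hT, h0⟩
    refine ⟨hT, fun X _ hle => funext fun e => ?_⟩
    exact ((hle e).resolve_left (h0 e)).symm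

theorem Loopless.cl_empty (hM : M.Loopless) : M.cl ∅ = ∅ := by
  rw [Set.eq_empty_iff_forall_notMem]
  intro e he
  obtain ⟨X, hX, hXe⟩ := hM e
  exact hXe (he X hX (by simp))

theorem Loopless.exists_tope [Finite E] (hM : M.Loopless) : ∃ T, T ∈ M.topes := by
  obtain ⟨X, hX, h⟩ := M.exists_covector_zeroSet_eq_cl ∅
  exact ⟨X, hM.mem_topes_iff.2 ⟨hX, fun e he => by
    rw [h, hM.cl_empty] at he; exact he⟩⟩

open Classical in
/-- The sign vector obtained from `T` by setting the coordinates in `F` to zero. -/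
noncomputable def zeroOn (F : Set E) (T : E → SignType) : E → SignType :=
  fun e => if e ∈ F then 0 else T e

theorem zeroOn_of_mem {F : Set E} {T : E → SignType} {e : E} (h : e ∈ F) : zeroOn F T e = 0 :=
  if_pos h

theorem zeroOn_of_notMem {F : Set E} {T : E → SignType} {e : E} (h : e ∉ F) :
    zeroOn F T e = T e :=
  if_neg h

@[simp]
theorem zeroOn_empty (T : E → SignType) : zeroOn ∅ T = T :=
  funext fun _ => zeroOn_of_notMem (Set.notMem_empty _)

theorem zeroOn_univ (T : E → SignType) : zeroOn Set.univ T = fun _ => 0 :=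
  funext fun _ => zeroOn_of_mem (Set.mem_univ _)

theorem mem_flagTopes_iff {F : M.FlatFlag} {T : E → SignType} :
    T ∈ M.flagTopes F ↔ T ∈ M.topes ∧ ∀ i, zeroOn (F.flat i) T ∈ M.covectors :=
  Iff.rfl

theorem mem_initialAt_covectors_iff {F : M.FlatFlag} {X : E → SignType} :
    X ∈ (M.initialAt F).covectors ↔ ∀ i : Fin F.length, ∃ Z ∈ M.covectors,
      (∀ e ∈ F.flat i.castSucc, Z e = 0) ∧ ∀ e ∈ F.block i, X e = Z e := by
  refine forall_congr' fun i => ⟨?_, ?_⟩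
  · rintro ⟨_, ⟨Z, hZ, rfl⟩, h0, h⟩
    refine ⟨Z, hZ, fun e he => ?_, fun e he => ?_⟩
    · exact h0 ⟨e, F.strictMono.monotone (Fin.castSucc_le_succ i) he⟩ he
    · exact congrFun h ⟨⟨e, he.1⟩, he.2⟩
  · rintro ⟨Z, hZ, h0, h⟩
    exact ⟨_, ⟨Z, hZ, rfl⟩, fun e he => h0 e he, funext fun b => h b ⟨b.1.2, b.2⟩⟩

theorem FlatFlag.exists_mem_block (F : M.FlatFlag) (e : E) : ∃ i, e ∈ F.block i := by
  obtain ⟨⟨i, b⟩, rfl⟩ := F.block_bijective.2 e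
  exact ⟨i, b.1.2, b.2⟩

theorem FlatFlag.block_index_unique (F : M.FlatFlag) {e : E} {i j : Fin F.length}
    (hi : e ∈ F.block i) (hj : e ∈ F.block j) : i = j :=
  congrArg Sigma.fst (@F.block_bijective.1 ⟨i, ⟨⟨e, hi.1⟩, hi.2⟩⟩ ⟨j, ⟨⟨e, hj.1⟩, hj.2⟩⟩ rfl)

theorem loopless_initialAt (F : M.FlatFlag) : (M.initialAt F).Loopless := by
  intro e
  choose Z hZ hZ0 using fun i : Fin F.length => F.isFlat i.castSucc
  choose idx hidx using F.exists_mem_block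
  refine ⟨fun f => Z (idx f) f, mem_initialAt_covectors_iff.2 fun i => ⟨Z i, hZ i, ?_, ?_⟩, ?_⟩
  · intro f hf
    rw [hZ0 i] at hf
    exact hf
  · intro f hf
    rw [F.block_index_unique (hidx f) hf]
  · intro h
    refine (hidx e).2 ?_
    rw [hZ0]
    exact h

/-- The topes of `M_F` are the topes `T` of `M` such that zeroing `T` on any member of `F`
gives a covector. -/
theorem topes_initialAt (hM : M.Loopless) (F : M.FlatFlag) :
    (M.initialAt F).topes = M.flagTopes F := by
  ext T
  rw [(loopless_initialAt F).mem_topes_iff, mem_initialAt_covectors_iff, mem_flagTopes_iff]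
  constructor
  · rintro ⟨hT, h0⟩
    have key : ∀ i, zeroOn (F.flat i) T ∈ M.covectors := by
      intro i
      induction i using Fin.reverseInduction with
      | last => rw [F.flat_last, zeroOn_univ]; exact M.zero_mem
      | cast i ih =>
        -- Compose with a covector realizing the signs of `T` on the block `F_{i+1} ∖ F_i`.
        obtain ⟨Z, hZ, hZ0, hZT⟩ := hT i
        convert M.comp_mem _ ih Z hZ using 1
        funext e
        have hsub := F.strictMono.monotone (Fin.castSucc_le_succ i)
        by_cases h1 : e ∈ F.flat i.castSucc
        · simp [signComp, zeroOn_of_mem h1, zeroOn_of_mem (hsub h1), hZ0 e h1]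
        · rw [zeroOn_of_notMem h1]
          by_cases h2 : e ∈ F.flat i.succ
          · simp [signComp, zeroOn_of_mem h2, hZT e ⟨h2, h1⟩]
          · simp [signComp, zeroOn_of_notMem h2, h0 e]
    refine ⟨hM.mem_topes_iff.2 ⟨?_, h0⟩, key⟩
    have := key 0
    rwa [F.flat_first, zeroOn_empty] at this
  · rintro ⟨hT, h⟩
    exact ⟨fun i => ⟨_, h i.castSucc, fun e he => zeroOn_of_mem he,
      fun e he => (zeroOn_of_notMem he.2).symm⟩, (hM.mem_topes_iff.1 hT).2⟩

theorem flagTopes_anti {F F' : M.FlatFlag} (h : Set.range F.flat ⊆ Set.range F'.flat) :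
    M.flagTopes F' ⊆ M.flagTopes F := by
  intro T hT
  rw [mem_flagTopes_iff] at hT ⊢
  refine ⟨hT.1, fun i => ?_⟩
  obtain ⟨j, hj⟩ := h ⟨i, rfl⟩
  exact hj ▸ hT.2 j

end Topes

end OrientedMatroid

/-! ### Coefficients in the square-free algebra -/

section SFSym

variable {E : Type*}

open scoped Classical in
theorem squarefreeExponent_apply (S : Finset E) (e : E) :
    squarefreeExponent S e = if e ∈ S then 1 else 0 := by
  simp [squarefreeExponent, Finsupp.finsetSum_apply, Finsupp.single_apply]

theorem sfCoeff_mk (S : Finset E) (q : MvPolynomial E ℤ) :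
    sfCoeff S (Ideal.Quotient.mk _ q) = MvPolynomial.coeff (squarefreeExponent S) q :=
  rfl

open scoped Classical in
theorem sfCoeff_one (S : Finset E) : sfCoeff S (1 : SFSym E) = if S = ∅ then 1 else 0 := by
  rw [← map_one (Ideal.Quotient.mk _), sfCoeff_mk, MvPolynomial.coeff_one]
  by_cases hS : S = ∅
  · simp [hS, squarefreeExponent]
  · obtain ⟨e, he⟩ := Finset.nonempty_iff_ne_empty.2 hS
    rw [if_neg hS, if_neg]
    intro h
    have := DFunLike.congr_fun h e
    simp [squarefreeExponent_apply, he] at this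

open scoped Classical in
theorem sfCoeff_mul_X (S : Finset E) (f : SFSym E) (e : E) :
    sfCoeff S (f * Ideal.Quotient.mk _ (MvPolynomial.X e)) =
      if e ∈ S then sfCoeff (S.erase e) f else 0 := by
  obtain ⟨q, rfl⟩ := Ideal.Quotient.mk_surjective f
  rw [← map_mul, sfCoeff_mk, sfCoeff_mk, MvPolynomial.coeff_mul_X']
  have h : e ∈ (squarefreeExponent S).support ↔ e ∈ S := by
    simp [squarefreeExponent_apply]
  simp only [h]
  split_ifs with he
  · congr 1
    ext f
    simp only [Finsupp.tsub_apply, squarefreeExponent_apply, Finsupp.single_apply,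
      Finset.mem_erase]
    by_cases hf : e = f
    · subst hf; simp [he]
    · simp [hf, Ne.symm hf]
  · rfl

/-- An element of `SFSym E` is determined by its coefficients. -/
theorem sfCoeff_ext {f g : SFSym E} (h : ∀ S, sfCoeff S f = sfCoeff S g) : f = g := by
  obtain ⟨q, rfl⟩ := Ideal.Quotient.mk_surjective f
  obtain ⟨r, rfl⟩ := Ideal.Quotient.mk_surjective g
  rw [Ideal.Quotient.eq]
  rw [show (fun e : E => (MvPolynomial.X e : MvPolynomial E ℤ) ^ 2) =
    fun e => MvPolynomial.monomial (Finsupp.single e 2) 1 from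
      funext fun e => MvPolynomial.X_pow_eq_monomial, show (Set.range fun e : E =>
      (MvPolynomial.monomial (Finsupp.single e 2) 1 : MvPolynomial E ℤ)) =
      (fun m => MvPolynomial.monomial m 1) '' Set.range fun e : E => Finsupp.single e 2 from
      Set.range_comp (fun m => MvPolynomial.monomial m 1) fun e => Finsupp.single e 2,
    MvPolynomial.mem_ideal_span_monomial_image]
  intro m hm
  by_contra! hle
  -- An exponent not divisible by any `x_e²` is that of a square-free monomial.
  have h1 : ∀ e, m e ≤ 1 := fun e => by
    by_contra! he
    exact hle _ ⟨e, rfl⟩ (by rw [Finsupp.single_le_iff]; exact he)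
  have hS : squarefreeExponent m.support = m := by
    classical
    ext e
    rw [squarefreeExponent_apply]
    have := h1 e
    split_ifs with he
    · rw [Finsupp.mem_support_iff] at he; omega
    · exact (Finsupp.notMem_support_iff.1 he).symm
  have := h m.support
  rw [sfCoeff_mk, sfCoeff_mk, hS] at this
  rw [MvPolynomial.mem_support_iff, MvPolynomial.coeff_sub, this, sub_self] at hm
  exact hm rfl

variable [Fintype E]

/-- The coefficient of `x^S`, as a linear map in all `S` at once, is an isomorphism. -/
noncomputable def sfEquiv (E : Type*) [Fintype E] : SFSym E ≃ₗ[ℤ] (Finset E → ℤ) :=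
  LinearEquiv.ofBijective
    (LinearMap.pi fun S : Finset E => (sfCoeff S).toIntLinearMap) <| by
    classical
    refine ⟨fun f g h => sfCoeff_ext fun S => congrFun h S, fun a => ?_⟩
    refine ⟨Ideal.Quotient.mk _
      (∑ S : Finset E, MvPolynomial.monomial (squarefreeExponent S) (a S)), funext fun S => ?_⟩
    rw [LinearMap.pi_apply, AddMonoidHom.coe_toIntLinearMap]
    rw [sfCoeff_mk, MvPolynomial.coeff_sum]
    simp only [MvPolynomial.coeff_monomial]
    rw [Finset.sum_eq_single S]
    · simp
    · intro R _ hR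
      refine if_neg fun h => hR (Finset.ext fun e => ?_)
      have := DFunLike.congr_fun h e
      simp only [squarefreeExponent_apply] at this
      split_ifs at this <;> simp_all
    · simp

@[simp]
theorem sfEquiv_apply (f : SFSym E) (S : Finset E) : sfEquiv E f S = sfCoeff S f :=
  rfl

@[simp]
theorem sfCoeff_sfEquiv_symm (a : Finset E → ℤ) (S : Finset E) :
    sfCoeff S ((sfEquiv E).symm a) = a S :=
  congrFun ((sfEquiv E).apply_symm_apply a) S

end SFSym

namespace OrientedMatroid

/-! ### The relations between the coefficients of a dual Cordovil element -/

section Dual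

open scoped Classical

variable {E : Type*}

/-- The support of a sign vector. -/
noncomputable def signSupp [Fintype E] (C : E → SignType) : Finset E :=
  Finset.univ.filter (C · ≠ 0)

@[simp]
theorem mem_signSupp [Fintype E] {C : E → SignType} {e : E} : e ∈ signSupp C ↔ C e ≠ 0 := by
  simp [signSupp]

/-- The transpose of multiplication by the monomial `x^U` of `ℤ[x_e]/⟨x_e²⟩`, on coefficient
families. -/
noncomputable def contractCoeff (U : Finset E) (a : Finset E → ℤ) : Finset E → ℤ :=
  fun S => if Disjoint U S then a (U ∪ S) else 0

theorem contractCoeff_empty (a : Finset E → ℤ) : contractCoeff ∅ a = a := by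
  funext S
  simp [contractCoeff]

theorem contractCoeff_contractCoeff_of_notMem {e : E} {U : Finset E} (he : e ∉ U)
    (a : Finset E → ℤ) :
    contractCoeff U (contractCoeff {e} a) = contractCoeff (insert e U) a := by
  funext S
  simp only [contractCoeff, Finset.disjoint_singleton_left, Finset.disjoint_insert_left,
    Finset.mem_union, he, false_or]
  rw [← Finset.insert_eq, Finset.insert_union]
  split_ifs <;> tauto

theorem contractCoeff_contractCoeff_of_mem {e : E} {U : Finset E} (he : e ∈ U)
    (a : Finset E → ℤ) :
    contractCoeff U (contractCoeff {e} a) = 0 := by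
  funext S
  simp [contractCoeff, he]

variable [Fintype E]

/-- The pairing of an element of `SFSym E` with a family of coefficients. -/
noncomputable def coeffPairing (a : Finset E → ℤ) : SFSym E →+ ℤ :=
  ∑ S : Finset E, (AddMonoidHom.mulRight (a S)).comp (sfCoeff S)

theorem coeffPairing_apply (a : Finset E → ℤ) (f : SFSym E) :
    coeffPairing a f = ∑ S : Finset E, sfCoeff S f * a S := by
  simp [coeffPairing, AddMonoidHom.finsetSum_apply]

theorem sfPairing_eq_coeffPairing (f g : SFSym E) :
    sfPairing f g = coeffPairing (fun S => sfCoeff S g) f :=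
  (coeffPairing_apply _ _).symm

theorem coeffPairing_mul_X (a : Finset E → ℤ) (f : SFSym E) (e : E) :
    coeffPairing a (f * Ideal.Quotient.mk _ (MvPolynomial.X e)) =
      coeffPairing (contractCoeff {e} a) f := by
  simp only [coeffPairing_apply, sfCoeff_mul_X, contractCoeff, Finset.disjoint_singleton_left,
    ite_mul, zero_mul, mul_ite, mul_zero]
  rw [← Finset.sum_filter, ← Finset.sum_filter]
  refine Finset.sum_bij' (fun S _ => S.erase e) (fun S _ => insert e S) ?_ ?_ ?_ ?_ ?_
  · simp
  · simp
  · intro S hS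
    exact Finset.insert_erase (Finset.mem_filter.1 hS).2
  · intro S hS
    exact Finset.erase_insert (Finset.mem_filter.1 hS).2
  · intro S hS
    rw [← Finset.insert_eq, Finset.insert_erase (Finset.mem_filter.1 hS).2]

theorem coeffPairing_mul_prod_X (a : Finset E → ℤ) (f : SFSym E) (U : Finset E) :
    coeffPairing a (f * Ideal.Quotient.mk _ (∏ e ∈ U, MvPolynomial.X e)) =
      coeffPairing (contractCoeff U a) f := by
  induction U using Finset.induction_on generalizing a with
  | empty => simp [contractCoeff_empty]
  | insert e U he ih =>
    rw [Finset.prod_insert he, map_mul (Ideal.Quotient.mk _),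
      mul_comm (Ideal.Quotient.mk _ (MvPolynomial.X e)),
      ← mul_assoc, coeffPairing_mul_X, ih, contractCoeff_contractCoeff_of_notMem he]

theorem coeffPairing_prod_X (a : Finset E → ℤ) (U : Finset E) :
    coeffPairing a (Ideal.Quotient.mk _ (∏ e ∈ U, MvPolynomial.X e)) = a U := by
  rw [← one_mul (Ideal.Quotient.mk _ _), coeffPairing_mul_prod_X, coeffPairing_apply]
  rw [Finset.sum_eq_single ∅]
  · simp [sfCoeff_one, contractCoeff]
  · intro S _ hS
    simp [sfCoeff_one, hS]
  · simp

theorem coeffPairing_circuitRelation (a : Finset E → ℤ) (C : E → SignType) :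
    coeffPairing a (Ideal.Quotient.mk _ (circuitRelation C)) =
      ∑ k, ((C k : SignType) : ℤ) * a ((signSupp C).erase k) := by
  rw [circuitRelation, map_sum, map_sum]
  refine Finset.sum_congr rfl fun k _ => ?_
  have h : Finset.univ.filter (fun j => C j ≠ 0 ∧ j ≠ k) = (signSupp C).erase k := by
    ext j
    simp [and_comm]
  rw [← smul_eq_mul (a := ((C k : SignType) : ℤ)), ← coeffPairing_prod_X a, ← h,
    ← MvPolynomial.smul_eq_C_mul, ← map_zsmul (coeffPairing a), ← map_zsmul]

/-- The families `a` of coefficients such that `∑_S a_S x^S` pairs to zero with the ideal defining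
the Cordovil algebra. -/
noncomputable def dualCoeff (M : OrientedMatroid E) : Submodule ℤ (Finset E → ℤ) where
  carrier := {a | ∀ C, M.IsSignedCircuit C → ∀ U,
    ∑ k, ((C k : SignType) : ℤ) * contractCoeff U a ((signSupp C).erase k) = 0}
  zero_mem' := by simp [contractCoeff]
  add_mem' := by
    intro a b ha hb C hC U
    have h := congrArg₂ (· + ·) (ha C hC U) (hb C hC U)
    simp only [← Finset.sum_add_distrib, add_zero] at h
    rw [← h]
    refine Finset.sum_congr rfl fun k _ => ?_
    rw [← mul_add]
    simp only [contractCoeff, Pi.add_apply]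
    split_ifs <;> simp
  smul_mem' := by
    intro c a ha C hC U
    rw [← mul_zero c, ← ha C hC U, Finset.mul_sum]
    refine Finset.sum_congr rfl fun k _ => ?_
    simp only [contractCoeff, Pi.smul_apply, smul_eq_mul]
    split_ifs
    · ring
    · simp

variable {M : OrientedMatroid E} {a : Finset E → ℤ}

theorem contractCoeff_mem_dualCoeff (ha : a ∈ M.dualCoeff) (e : E) :
    contractCoeff {e} a ∈ M.dualCoeff := by
  intro C hC U
  by_cases he : e ∈ U
  · simp [contractCoeff_contractCoeff_of_mem he]
  · rw [contractCoeff_contractCoeff_of_notMem he]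
    exact ha C hC _

theorem coeffPairing_mul_circuitRelation {C : E → SignType} (hC : M.IsSignedCircuit C)
    (q : MvPolynomial E ℤ) :
    ∀ a ∈ M.dualCoeff, coeffPairing a (Ideal.Quotient.mk _ (q * circuitRelation C)) = 0 := by
  induction q using MvPolynomial.induction_on with
  | C c =>
    intro a ha
    rw [← MvPolynomial.smul_eq_C_mul]
    have h := ha C hC ∅
    rw [contractCoeff_empty, ← coeffPairing_circuitRelation] at h
    rw [map_zsmul, map_zsmul, h, smul_zero]
  | add q r hq hr =>
    intro a ha
    rw [add_mul, map_add, map_add, hq a ha, hr a ha, add_zero]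
  | mul_X q e hq =>
    intro a ha
    rw [mul_right_comm, map_mul, coeffPairing_mul_X]
    exact hq _ (contractCoeff_mem_dualCoeff ha e)

theorem mem_dualCordovil_iff {p : ℕ} {f : SFSym E} :
    f ∈ M.dualCordovil p ↔
      (∀ S : Finset E, S.card ≠ p → sfCoeff S f = 0) ∧ (fun S => sfCoeff S f) ∈ M.dualCoeff := by
  refine and_congr_right fun _ => ⟨fun h C hC U => ?_, fun h r hr => ?_⟩
  · have := h (circuitRelation C * ∏ e ∈ U, MvPolynomial.X e)
      (Ideal.mul_mem_right _ _ <| Ideal.mem_sup_right <| Ideal.subset_span ⟨C, hC, rfl⟩)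
    rwa [sfPairing_eq_coeffPairing, map_mul, coeffPairing_mul_prod_X,
      coeffPairing_circuitRelation] at this
  · obtain ⟨s, hs, t, ht, rfl⟩ := Submodule.mem_sup.1 hr
    rw [sfPairing_eq_coeffPairing, map_add, Ideal.Quotient.eq_zero_iff_mem.2 hs, zero_add]
    suffices ∀ q, coeffPairing (fun S => sfCoeff S f) (Ideal.Quotient.mk _ (q * t)) = 0 by
      simpa using this 1
    clear hr
    induction ht using Submodule.span_induction with
    | mem x hx =>
      obtain ⟨C, hC, rfl⟩ := hx
      exact fun q => coeffPairing_mul_circuitRelation hC q _ h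
    | zero => simp
    | add x y _ _ hx hy =>
      intro q
      rw [mul_add, map_add, map_add, hx, hy, add_zero]
    | smul c x _ hx =>
      intro q
      rw [smul_eq_mul, ← mul_assoc]
      exact hx _

theorem eq_zero_of_signSupp_subset (ha : a ∈ M.dualCoeff) {C : E → SignType}
    (hC : M.IsSignedCircuit C) {S : Finset E} (hS : signSupp C ⊆ S) : a S = 0 := by
  obtain ⟨k, hk⟩ := hC.2.1
  -- With `U` containing `k`, only the term of the relation that omits `k` survives.
  have h := ha C hC (insert k (S \ signSupp C))
  rw [Finset.sum_eq_single k] at h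
  · have hd : Disjoint (insert k (S \ signSupp C)) ((signSupp C).erase k) := by
      rw [Finset.disjoint_left]
      intro j
      simp only [Finset.mem_insert, Finset.mem_sdiff, Finset.mem_erase]
      tauto
    have hu : insert k (S \ signSupp C) ∪ (signSupp C).erase k = S := by
      ext j
      have := @hS j
      have := @hS k
      by_cases hj : j = k
      · subst hj; simp_all
      · simp only [Finset.mem_union, Finset.mem_insert, Finset.mem_sdiff, Finset.mem_erase]
        tauto
    rw [contractCoeff, if_pos hd, hu] at h
    exact (mul_eq_zero.1 h).resolve_left (by revert hk; generalize C k = x; revert x; decide)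
  · intro j _ hj
    rw [contractCoeff, if_neg, mul_zero]
    rw [Finset.not_disjoint_iff]
    exact ⟨k, by simp, by simp [hk, Ne.symm hj]⟩
  · simp

theorem indep_of_ne_zero (ha : a ∈ M.dualCoeff) {S : Finset E} (h : a S ≠ 0) :
    M.Indep (S : Set E) := by
  by_contra hS
  obtain ⟨C, hC, hCS⟩ := exists_isSignedCircuit_of_not_indep hS
  exact h (eq_zero_of_signSupp_subset ha hC fun e he => hCS e (mem_signSupp.1 he))

/-- The part of a coefficient family on the sets with closure `G`. -/
noncomputable def flatPart (M : OrientedMatroid E) (G : Set E) (a : Finset E → ℤ) :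
    Finset E → ℤ :=
  fun S => if M.cl (S : Set E) = G then a S else 0

/-- The relations are homogeneous for the grading by flats: omitting an element of a circuit does
not change the closure. -/
theorem flatPart_mem_dualCoeff (ha : a ∈ M.dualCoeff) (G : Set E) :
    M.flatPart G a ∈ M.dualCoeff := by
  intro C hC U
  have hcl : ∀ k, C k ≠ 0 → M.cl ((U ∪ (signSupp C).erase k : Finset E) : Set E) =
      M.cl ((U ∪ signSupp C : Finset E) : Set E) := by
    intro k hk
    refine (cl_mono ?_).antisymm (cl_subset_cl fun e he => ?_)
    · exact_mod_cast Finset.union_subset_union_right (Finset.erase_subset _ _)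
    · by_cases hek : e = k
      · subst hek
        refine cl_mono (fun j hj => ?_) (hC.1.mem_cl hk)
        have hj : C j ≠ 0 ∧ j ≠ e := hj
        simp [hj.1, hj.2]
      · refine subset_cl _ ?_
        simp only [Finset.coe_union, Set.mem_union, Finset.mem_coe, Finset.mem_erase] at he ⊢
        tauto
  by_cases hG : M.cl ((U ∪ signSupp C : Finset E) : Set E) = G
  · rw [← ha C hC U]
    refine Finset.sum_congr rfl fun k _ => ?_
    by_cases hk : C k = 0
    · simp [hk]
    · simp only [contractCoeff, flatPart, hcl k hk, hG, if_true]
  · refine Finset.sum_eq_zero fun k _ => ?_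
    by_cases hk : C k = 0
    · simp [hk]
    · simp only [contractCoeff, flatPart, hcl k hk, hG, if_false, ite_self, mul_zero]

theorem sum_flatPart (a : Finset E → ℤ) : ∑ G : Set E, M.flatPart G a = a := by
  funext S
  simp [flatPart, Finset.sum_apply]

/-- The fundamental circuit of `S ∪ {e}` expresses `a_S` by coefficients of sets containing
`e`. -/
theorem eq_zero_of_forall_mem_eq_zero (ha : a ∈ M.dualCoeff) {G : Set E}
    (hG : ∀ S, a S ≠ 0 → M.cl (S : Set E) = G) {e : E} (he : e ∈ G)
    (h : ∀ S, e ∈ S → a S = 0) : a = 0 := by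
  funext S
  by_contra hS
  have heS : e ∉ S := fun h' => hS (h S h')
  obtain ⟨C, hC, hCe, hCS⟩ := exists_isSignedCircuit (indep_of_ne_zero ha hS) heS
    (by rw [hG S hS]; exact he)
  have hrel := ha C hC (S \ signSupp C)
  rw [Finset.sum_eq_single e] at hrel
  · have hd : Disjoint (S \ signSupp C) ((signSupp C).erase e) :=
      Finset.sdiff_disjoint.mono_right (Finset.erase_subset _ _)
    have hu : S \ signSupp C ∪ (signSupp C).erase e = S := by
      ext j
      have := hCS j
      by_cases hj : j = e
      · subst hj; simp [heS, hCe]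
      · simp only [Finset.mem_union, Finset.mem_sdiff, Finset.mem_erase, mem_signSupp]
        tauto
    rw [contractCoeff, if_pos hd, hu] at hrel
    rcases mul_eq_zero.1 hrel with h0 | h0
    · revert h0 hCe; generalize C e = x; revert x; decide
    · exact hS h0
  · intro k _ hk
    rw [contractCoeff]
    split_ifs
    · rw [h _ (by simp [hCe, Ne.symm hk]), mul_zero]
    · simp
  · simp

end Dual

/-! ### Top coefficients of the dual filtration -/

section Heaviside

open scoped Classical

variable {E : Type*}

/-- The monomial `∏_{e ∈ S} h_e` in the Heaviside functions, as a function on all sign vectors. -/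
def heavisideMonomial (S : Finset E) (T : E → SignType) : ℤ :=
  ∏ e ∈ S, if T e = 1 then 1 else 0

/-- The pairing of `∏_{e ∈ S} h_e` with chains of sign vectors. -/
noncomputable def heavisidePairing (S : Finset E) : ((E → SignType) →₀ ℤ) →ₗ[ℤ] ℤ :=
  Finsupp.linearCombination ℤ (heavisideMonomial S)

@[simp]
theorem heavisidePairing_single (S : Finset E) (T : E → SignType) (c : ℤ) :
    heavisidePairing S (Finsupp.single T c) = c * heavisideMonomial S T := by
  simp [heavisidePairing]

variable {M : OrientedMatroid E}

theorem evalPairing_restrict {γ : (E → SignType) →₀ ℤ} (hγ : γ ∈ M.topeSpace)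
    (φ : (E → SignType) → ℤ) :
    M.evalPairing (fun T => φ T.1) γ = Finsupp.linearCombination ℤ φ γ := by
  rw [evalPairing, LinearMap.comp_apply, Finsupp.linearCombination_apply,
    Finsupp.linearCombination_apply]
  exact Finsupp.sum_subtypeDomain_index (h := fun T c => c • φ T) hγ

theorem aeval_heaviside_apply (q : MvPolynomial E ℤ) (T : M.topes) :
    MvPolynomial.aeval M.heaviside q T =
      ∑ m ∈ q.support, MvPolynomial.coeff m q * heavisideMonomial m.support T.1 := by
  rw [MvPolynomial.aeval_def, MvPolynomial.eval₂_eq, Finset.sum_apply]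
  refine Finset.sum_congr rfl fun m _ => ?_
  rw [Pi.mul_apply, Finset.prod_apply]
  congr 1
  refine Finset.prod_congr rfl fun e he => ?_
  have := Finsupp.mem_support_iff.1 he
  simp only [Pi.pow_apply, heaviside]
  split_ifs <;> simp [this]

theorem mem_dualFiltration_iff {p : ℕ} {γ : (E → SignType) →₀ ℤ} :
    γ ∈ M.dualFiltration p ↔
      γ ∈ M.topeSpace ∧ ∀ S : Finset E, S.card < p → heavisidePairing S γ = 0 := by
  rw [dualFiltration, Submodule.mem_inf]
  refine and_congr_right fun hγ => ?_
  simp only [Submodule.mem_iInf, LinearMap.mem_ker]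
  constructor
  · intro h S hS
    have hmem : (fun T : M.topes => heavisideMonomial S T.1) ∈
        M.degreeFiltration ((p : ℤ) - 1) := by
      refine Or.inr ⟨∏ e ∈ S, MvPolynomial.X e, ?_, ?_⟩
      · have h1 := MvPolynomial.totalDegree_finsetProd S
          fun e => (MvPolynomial.X e : MvPolynomial E ℤ)
        simp only [MvPolynomial.totalDegree_X, Finset.sum_const, smul_eq_mul, mul_one] at h1
        omega
      · funext T
        rw [map_prod, Finset.prod_apply]
        simp [heavisideMonomial, heaviside]
    have := h _ hmem
    rwa [evalPairing_restrict hγ] at this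
  · rintro h f (rfl | ⟨q, hq, rfl⟩)
    · exact evalPairing_restrict hγ 0 ▸ by simp
    · have heq : MvPolynomial.aeval M.heaviside q = fun T : M.topes =>
          (∑ m ∈ q.support, MvPolynomial.coeff m q • heavisideMonomial m.support) T.1 := by
        funext T
        simp [aeval_heaviside_apply, Finset.sum_apply]
      rw [heq, evalPairing_restrict hγ]
      have hlin : Finsupp.linearCombination ℤ
          (∑ m ∈ q.support, MvPolynomial.coeff m q • heavisideMonomial m.support) γ =
          ∑ m ∈ q.support, MvPolynomial.coeff m q * heavisidePairing m.support γ := by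
        simp only [heavisidePairing, Finsupp.linearCombination_apply, Finsupp.sum,
          Finset.sum_apply, Pi.smul_apply, smul_eq_mul, Finset.mul_sum]
        rw [Finset.sum_comm]
        exact Finset.sum_congr rfl fun m _ => Finset.sum_congr rfl fun T _ => by ring
      rw [hlin]
      refine Finset.sum_eq_zero fun m hm => ?_
      rw [h m.support, mul_zero]
      have h1 : m.support.card ≤ m.sum fun _ n => n := by
        rw [Finset.card_eq_sum_ones]
        exact Finset.sum_le_sum fun e he => Nat.one_le_iff_ne_zero.2 (Finsupp.mem_support_iff.1 he)
      have h2 := MvPolynomial.le_totalDegree hm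
      omega

theorem dualFiltration_anti {p q : ℕ} (h : p ≤ q) : M.dualFiltration q ≤ M.dualFiltration p := by
  intro γ hγ
  rw [mem_dualFiltration_iff] at hγ ⊢
  exact ⟨hγ.1, fun S hS => hγ.2 S (hS.trans_le h)⟩

theorem dualFiltration_mono {M' : OrientedMatroid E} (h : M'.topes ⊆ M.topes) (p : ℕ) :
    M'.dualFiltration p ≤ M.dualFiltration p := by
  intro γ hγ
  rw [mem_dualFiltration_iff] at hγ ⊢
  exact ⟨Finsupp.supported_mono h hγ.1, hγ.2⟩

/-- The monomials of degree at most `|E|` separate topes: among the topes in the support of `γ`,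
one with the largest set of positive coordinates is seen by the corresponding monomial. -/
theorem Loopless.dualFiltration_eq_bot [Fintype E] (hM : M.Loopless) :
    M.dualFiltration (Fintype.card E + 1) = ⊥ := by
  rw [eq_bot_iff]
  intro γ hγ
  rw [mem_dualFiltration_iff] at hγ
  rw [Submodule.mem_bot]
  by_contra hne
  let P : (E → SignType) → Finset E := fun T => Finset.univ.filter (T · = 1)
  obtain ⟨T, hT, hmax⟩ := Finset.exists_max_image γ.support (fun T => (P T).card)
    (Finsupp.support_nonempty_iff.2 hne)
  have h := hγ.2 (P T) (Nat.lt_succ_of_le (Finset.card_le_univ _))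
  rw [heavisidePairing, Finsupp.linearCombination_apply, Finsupp.sum,
    Finset.sum_eq_single_of_mem T hT] at h
  · have h1 : heavisideMonomial (P T) T = 1 :=
      Finset.prod_eq_one fun e he => if_pos (Finset.mem_filter.1 he).2
    rw [h1, smul_eq_mul, mul_one] at h
    exact Finsupp.mem_support_iff.1 hT h
  · intro T' hT' hTT'
    suffices heavisideMonomial (P T) T' = 0 by rw [this, smul_zero]
    by_contra h0
    have hsub : P T ⊆ P T' := fun e he => by
      have := Finset.prod_ne_zero_iff.1 h0 e he
      simp only [P, Finset.mem_filter, Finset.mem_univ, true_and]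
      by_contra h'
      simp [h'] at this
    have heq : P T = P T' := Finset.eq_of_subset_of_card_le hsub (hmax T' hT')
    refine hTT' (funext fun e => ?_)
    have h1 : T e = 1 ↔ T' e = 1 := by
      have := Finset.ext_iff.1 heq e
      simpa [P] using this
    have h2 := (hM.mem_topes_iff.1 (hγ.1 hT)).2 e
    have h3 := (hM.mem_topes_iff.1 (hγ.1 hT')).2 e
    revert h1 h2 h3
    generalize T e = x; generalize T' e = y; revert x y; decide

theorem sum_powerset_of_card_lt {ι : Type*} (N : Finset ι) (f : Finset ι → ℤ)
    (hf : ∀ B ⊆ N, B.card + 1 < N.card → f B = 0) :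
    ∑ B ∈ N.powerset, f B = f N + ∑ k ∈ N, f (N.erase k) := by
  have hinj : Set.InjOn N.erase (N : Set ι) := Finset.erase_injOn N
  have hnot : N ∉ N.image N.erase := by
    simp only [Finset.mem_image, not_exists, not_and]
    intro k hk h
    exact Finset.notMem_erase k N (h.symm ▸ hk)
  rw [← Finset.sum_image (f := f) hinj, ← Finset.sum_insert hnot]
  refine (Finset.sum_subset ?_ fun B hB hB' => hf B (Finset.mem_powerset.1 hB) ?_).symm
  · intro B hB
    rcases Finset.mem_insert.1 hB with rfl | hB
    · simp
    · obtain ⟨k, _, rfl⟩ := Finset.mem_image.1 hB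
      simp [Finset.erase_subset]
  · rw [Finset.mem_powerset] at hB
    simp only [Finset.mem_insert, Finset.mem_image, not_or, not_exists, not_and] at hB'
    obtain ⟨k, hk, hkB⟩ := Finset.exists_of_ssubset (hB.ssubset_of_ne hB'.1)
    have hsub : B ⊆ N.erase k := Finset.subset_erase.2 ⟨hB, hkB⟩
    have h1 := Finset.card_lt_card (hsub.ssubset_of_ne (Ne.symm (hB'.2 k hk)))
    rw [Finset.card_erase_of_mem hk] at h1
    omega

/-- The coefficients of `ã_p γ`: the values of `γ` on the monomials of degree `p` in the Heaviside
functions. -/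
noncomputable def topCoeff (p : ℕ) : ((E → SignType) →₀ ℤ) →ₗ[ℤ] (Finset E → ℤ) :=
  LinearMap.pi fun S => if S.card = p then heavisidePairing S else 0

theorem topCoeff_apply (p : ℕ) (γ : (E → SignType) →₀ ℤ) (S : Finset E) :
    topCoeff p γ S = if S.card = p then heavisidePairing S γ else 0 := by
  rw [topCoeff, LinearMap.pi_apply]
  split_ifs <;> rfl

variable [Fintype E]

/-- No tope has the signs prescribed by a vector `C`, so
`h^U ∏_{C j = +} h_j ∏_{C j = -} (1 - h_j)` vanishes on topes. The two top degrees of its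
expansion are compared here. -/
theorem heavisidePairing_vector (hM : M.Loopless) {C : E → SignType} (hC : M.IsVector C)
    (hC0 : ∃ e, C e ≠ 0) {γ : (E → SignType) →₀ ℤ} (hγ : γ ∈ M.topeSpace) {U : Finset E}
    (hU : Disjoint U (signSupp C))
    (h : ∀ S : Finset E, S.card + 1 < U.card + (signSupp C).card → heavisidePairing S γ = 0) :
    heavisidePairing (U ∪ signSupp C) γ =
      ∑ k ∈ Finset.univ.filter (C · = -1), heavisidePairing (U ∪ (signSupp C).erase k) γ := by
  set P := Finset.univ.filter (C · = 1) with hP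
  set N := Finset.univ.filter (C · = -1) with hN
  have hPN : Disjoint P N := by
    rw [Finset.disjoint_left]
    intro e he he'
    simp only [hP, hN, Finset.mem_filter, Finset.mem_univ, true_and] at he he'
    rw [he] at he'; exact absurd he' (by decide)
  have hsupp : signSupp C = P ∪ N := by
    ext e
    simp only [mem_signSupp, hP, hN, Finset.mem_union, Finset.mem_filter, Finset.mem_univ,
      true_and]
    generalize C e = x; revert x; decide
  have hUP : Disjoint U P := hU.mono_right (hsupp ▸ Finset.subset_union_left)
  have hUN : Disjoint U N := hU.mono_right (hsupp ▸ Finset.subset_union_right)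
  have hd : Disjoint (U ∪ P) N := Finset.disjoint_union_left.2 ⟨hUN, hPN⟩
  have hexp : ∀ T : E → SignType, ∑ B ∈ N.powerset, (-1) ^ B.card *
      heavisideMonomial (U ∪ P ∪ B) T =
      heavisideMonomial (U ∪ P) T * ∏ e ∈ N, (1 - if T e = 1 then 1 else 0) := by
    intro T
    simp only [Finset.prod_sub, Finset.prod_const_one, mul_one, Finset.mul_sum]
    refine Finset.sum_congr rfl fun B hB => ?_
    rw [heavisideMonomial, Finset.prod_union (hd.mono_right (Finset.mem_powerset.1 hB))]
    simp only [heavisideMonomial]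
    ring
  have hzero : ∑ B ∈ N.powerset, (-1) ^ B.card * heavisidePairing (U ∪ P ∪ B) γ = 0 := by
    simp only [heavisidePairing, Finsupp.linearCombination_apply, Finsupp.sum, Finset.mul_sum]
    rw [Finset.sum_comm]
    refine Finset.sum_eq_zero fun T hT => ?_
    have hTt := hM.mem_topes_iff.1 (hγ hT)
    suffices h0 : heavisideMonomial (U ∪ P) T *
        ∏ e ∈ N, (1 - if T e = 1 then (1 : ℤ) else 0) = 0 by
      rw [← mul_zero (γ T), ← h0, ← hexp, Finset.mul_sum]
      exact Finset.sum_congr rfl fun B _ => by rw [smul_eq_mul]; ring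
    obtain ⟨e, he⟩ : ∃ e, C e * T e = -1 := by
      rcases hC T hTt.1 with h | h
      · obtain ⟨e, he⟩ := hC0
        exact absurd (h e) (mul_ne_zero he (hTt.2 e))
      · exact h.2
    have hcase : C e = 1 ∧ T e = -1 ∨ C e = -1 ∧ T e = 1 := by
      revert he; generalize C e = x; generalize T e = y; revert x y; decide
    rcases hcase with ⟨h1, h2⟩ | ⟨h1, h2⟩
    · rw [heavisideMonomial, Finset.prod_eq_zero (i := e), zero_mul]
      · simp [hP, h1]
      · rw [h2]; decide
    · rw [Finset.prod_eq_zero (i := e) (s := N), mul_zero]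
      · simp [hN, h1]
      · simp [h2]
  rw [sum_powerset_of_card_lt] at hzero
  · have hsum : ∑ k ∈ N, (-1) ^ (N.erase k).card * heavisidePairing (U ∪ P ∪ N.erase k) γ =
        -((-1) ^ N.card * ∑ k ∈ N, heavisidePairing (U ∪ (signSupp C).erase k) γ) := by
      rw [Finset.mul_sum, ← Finset.sum_neg_distrib]
      refine Finset.sum_congr rfl fun k hk => ?_
      have hk' : k ∉ P := Finset.disjoint_right.1 hPN hk
      rw [Finset.union_assoc, hsupp, Finset.erase_union_distrib, Finset.erase_eq_of_notMem hk',
        ← Finset.card_erase_add_one hk, pow_succ]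
      ring
    rw [hsum, Finset.union_assoc, ← hsupp, ← sub_eq_add_neg, ← mul_sub] at hzero
    exact sub_eq_zero.1 ((mul_eq_zero.1 hzero).resolve_left (pow_ne_zero _ (by decide)))
  · intro B hB hBN
    rw [h, mul_zero]
    rw [Finset.card_union_of_disjoint (hd.mono_right hB), Finset.card_union_of_disjoint hUP, hsupp,
      Finset.card_union_of_disjoint hPN]
    omega

theorem topCoeff_mem_dualCoeff (hM : M.Loopless) {p : ℕ} {γ : (E → SignType) →₀ ℤ}
    (hγ : γ ∈ M.dualFiltration p) : topCoeff p γ ∈ M.dualCoeff := by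
  rw [mem_dualFiltration_iff] at hγ
  obtain ⟨hγt, hγ0⟩ := hγ
  intro C hC U
  by_cases hU : Disjoint U (signSupp C)
  · have hcard : ∀ k, C k ≠ 0 →
        (U ∪ (signSupp C).erase k).card + 1 = U.card + (signSupp C).card := by
      intro k hk
      rw [Finset.card_union_of_disjoint (hU.mono_right (Finset.erase_subset _ _)), add_assoc,
        Finset.card_erase_add_one (mem_signSupp.2 hk)]
    by_cases hp : U.card + (signSupp C).card = p + 1
    · have hlow : ∀ S : Finset E, S.card + 1 < U.card + (signSupp C).card →
          heavisidePairing S γ = 0 := fun S hS => hγ0 S (by omega)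
      have h1 := heavisidePairing_vector hM hC.1 hC.2.1 hγt hU hlow
      have hneg : signSupp (fun e => -C e) = signSupp C := by
        ext e; simp
      have h2 := heavisidePairing_vector hM (C := fun e => -C e) (γ := γ) (U := U)
        (fun X hX => by
          have := hC.1 _ (M.neg_mem X hX)
          simpa [signOrthogonal] using this)
        (by simpa using hC.2.1) hγt (hneg.symm ▸ hU) (hneg.symm ▸ hlow)
      rw [hneg, h1] at h2
      have hterm : ∀ k, ((C k : SignType) : ℤ) *
          contractCoeff U (topCoeff p γ) ((signSupp C).erase k) =
          (if C k = 1 then heavisidePairing (U ∪ (signSupp C).erase k) γ else 0) -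
          if C k = -1 then heavisidePairing (U ∪ (signSupp C).erase k) γ else 0 := by
        intro k
        by_cases hk : C k = 0
        · simp [hk]
        · rw [contractCoeff, if_pos (hU.mono_right (Finset.erase_subset _ _)), topCoeff_apply,
            if_pos (by have := hcard k hk; omega)]
          have hk' : C k = 1 ∨ C k = -1 := by
            revert hk; generalize C k = x; revert x; decide
          rcases hk' with h | h <;> simp [h]
      simp only [hterm, Finset.sum_sub_distrib, ← Finset.sum_filter]
      rw [h2, sub_eq_zero]
      refine Finset.sum_congr (Finset.filter_congr fun k _ => ?_) fun _ _ => rfl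
      generalize C k = x; revert x; decide
    · refine Finset.sum_eq_zero fun k _ => ?_
      by_cases hk : C k = 0
      · simp [hk]
      · rw [contractCoeff, topCoeff_apply, if_neg (c := _ = p)
          (by have := hcard k hk; omega), ite_self, mul_zero]
  · refine Finset.sum_eq_zero fun k _ => ?_
    by_cases hk : C k = 0
    · simp [hk]
    rw [contractCoeff, topCoeff_apply]
    split_ifs with hd hp
    · -- Here `U` meets the circuit in `k` only, so the monomial contains the whole circuit.
      have hkU : k ∈ U := by
        obtain ⟨j, hj, hj'⟩ := Finset.not_disjoint_iff.1 hU
        by_contra hkU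
        exact Finset.disjoint_left.1 hd hj
          (Finset.mem_erase.2 ⟨fun h => hkU (h ▸ hj), hj'⟩)
      have hkC : k ∈ signSupp C := mem_signSupp.2 hk
      have hset : U ∪ (signSupp C).erase k = U.erase k ∪ signSupp C := by
        ext j
        by_cases hj : j = k
        · subst hj; simp [hkU, hk]
        · simp [hj]
      have hd' : Disjoint (U.erase k) (signSupp C) := by
        rw [Finset.disjoint_left] at hd ⊢
        intro j hj hj'
        rw [Finset.mem_erase] at hj
        exact hd hj.2 (Finset.mem_erase.2 ⟨hj.1, hj'⟩)
      have hp' : (U.erase k).card + (signSupp C).card = p := by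
        rw [← Finset.card_union_of_disjoint hd', ← hset, hp]
      rw [hset, heavisidePairing_vector hM hC.1 hC.2.1 hγt hd' fun S hS => hγ0 S (by omega)]
      rw [Finset.sum_eq_zero, mul_zero]
      intro j hj
      refine hγ0 _ (lt_of_le_of_lt (Finset.card_union_le _ _) ?_)
      have hj' : j ∈ signSupp C := by
        rw [mem_signSupp, (Finset.mem_filter.1 hj).2]; decide
      have := Finset.card_erase_add_one hj'
      omega
    · simp
    · simp

/-- The map `ã_p`, given by `γ ↦ ∑_{|S| = p} ⟨∏_{e ∈ S} h_e, γ⟩ x^S`. -/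
noncomputable def symbolMap (hM : M.Loopless) (p : ℕ) :
    M.dualFiltration p →ₗ[ℤ] M.dualCordovil p :=
  ((sfEquiv E).symm.toLinearMap ∘ₗ topCoeff p).restrict fun γ hγ => by
    rw [mem_dualCordovil_iff]
    refine ⟨fun S hS => ?_, ?_⟩
    · rw [LinearMap.comp_apply, LinearEquiv.coe_coe, sfCoeff_sfEquiv_symm, topCoeff_apply,
        if_neg hS]
    · convert topCoeff_mem_dualCoeff hM hγ using 1
      funext S
      simp

theorem symbolMap_apply (hM : M.Loopless) {p : ℕ} (γ : M.dualFiltration p) :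
    (symbolMap hM p γ : SFSym E) = (sfEquiv E).symm (topCoeff p γ) :=
  rfl

theorem symbolMap_eq_zero_iff (hM : M.Loopless) {p : ℕ} (γ : M.dualFiltration p) :
    symbolMap hM p γ = 0 ↔ (γ : (E → SignType) →₀ ℤ) ∈ M.dualFiltration (p + 1) := by
  have hγ := mem_dualFiltration_iff.1 γ.2
  rw [← Submodule.coe_eq_zero, symbolMap_apply, LinearEquiv.map_eq_zero_iff,
    mem_dualFiltration_iff]
  constructor
  · refine fun h => ⟨hγ.1, fun S hS => ?_⟩
    rcases Nat.lt_succ_iff_lt_or_eq.1 hS with h' | h'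
    · exact hγ.2 S h'
    · have := congrFun h S
      rwa [topCoeff_apply, if_pos h'] at this
  · rintro ⟨-, h⟩
    funext S
    rw [topCoeff_apply]
    split_ifs with hS
    · exact h S (by omega)
    · rfl

end Heaviside

/-! ### Initial segments of complete flags -/

section Prefix

open scoped Classical

variable {E : Type*}

/-- No flat lies strictly between `H` and `G`, and `H ⊂ G`. -/
def Covers (M : OrientedMatroid E) (H G : Set E) : Prop :=
  H ⊂ G ∧ ∀ K, M.IsFlat K → H ⊂ K → K ⊆ G → K = G

/-- The sets `s 0, …, s n` form the beginning of a complete flag of flats, and zeroing the tope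
`T` on any of them gives a covector. The flag is indexed by all natural numbers; the members after
`s n` are irrelevant. -/
structure IsFlagPrefix (M : OrientedMatroid E) (n : ℕ) (s : ℕ → Set E) (T : E → SignType) :
    Prop where
  zero : s 0 = ∅
  covers : ∀ i < n, M.Covers (s i) (s (i + 1))
  tope : T ∈ M.topes
  zeroOn_mem : ∀ i ≤ n, zeroOn (s i) T ∈ M.covectors

/-- The sign vector obtained from `T` by changing the signs on `B`. -/
noncomputable def flipOn (B : Set E) (T : E → SignType) : E → SignType :=
  fun e => if e ∈ B then -T e else T e

/-- The chain `γ_{F,T,p}`, defined recursively. -/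
noncomputable def flagChain (s : ℕ → Set E) : ℕ → (E → SignType) → ((E → SignType) →₀ ℤ)
  | 0, T => Finsupp.single T 1
  | p + 1, T => flagChain s p T - flagChain s p (flipOn (s (p + 1) \ s p) T)

/-- Multiplication by the linear form `∑_j σ_j x_j`, on coefficient families. -/
noncomputable def mulLinear (σ : E → ℤ) : (Finset E → ℤ) →ₗ[ℤ] (Finset E → ℤ) where
  toFun a S := ∑ j ∈ S, σ j * a (S.erase j)
  map_add' a b := by
    funext S
    simp [mul_add, Finset.sum_add_distrib]
  map_smul' c a := by
    funext S
    simp [Finset.mul_sum, mul_left_comm]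

theorem mulLinear_apply (σ : E → ℤ) (a : Finset E → ℤ) (S : Finset E) :
    mulLinear σ a S = ∑ j ∈ S, σ j * a (S.erase j) :=
  rfl

/-- The values of the sign vector `Y` on `B`, and zero outside `B`. -/
noncomputable def signOn (B : Set E) (Y : E → SignType) (j : E) : ℤ :=
  if j ∈ B then ((Y j : SignType) : ℤ) else 0

/-- The coefficients of `ε_{F,T,p}`, defined recursively. -/
noncomputable def flagCoeff (s : ℕ → Set E) (T : E → SignType) : ℕ → (Finset E → ℤ)
  | 0 => fun S => if S = ∅ then 1 else 0
  | p + 1 => mulLinear (signOn (s (p + 1) \ s p) T) (flagCoeff s T p)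

variable {M : OrientedMatroid E} {n p : ℕ} {s : ℕ → Set E} {T : E → SignType}

theorem Covers.subset {H G : Set E} (h : M.Covers H G) : H ⊆ G := h.1.1

theorem subset_of_forall_subset_succ (hs : ∀ i < n, s i ⊆ s (i + 1)) {i j : ℕ} (hij : i ≤ j)
    (hj : j ≤ n) : s i ⊆ s j := by
  induction j, hij using Nat.le_induction with
  | base => exact subset_rfl
  | succ j _ ih => exact (ih (by omega)).trans (hs j (by omega))

theorem IsFlagPrefix.subset_succ (h : M.IsFlagPrefix n s T) : ∀ i < n, s i ⊆ s (i + 1) :=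
  fun i hi => (h.covers i hi).subset

theorem IsFlagPrefix.subset (h : M.IsFlagPrefix n s T) {i j : ℕ} (hij : i ≤ j) (hj : j ≤ n) :
    s i ⊆ s j :=
  subset_of_forall_subset_succ h.subset_succ hij hj

theorem IsFlagPrefix.mono (h : M.IsFlagPrefix n s T) (hp : p ≤ n) : M.IsFlagPrefix p s T :=
  ⟨h.zero, fun i hi => h.covers i (by omega), h.tope, fun i hi => h.zeroOn_mem i (by omega)⟩

theorem IsFlagPrefix.isFlat (hM : M.Loopless) (h : M.IsFlagPrefix n s T) {i : ℕ} (hi : i ≤ n) :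
    M.IsFlat (s i) := by
  refine ⟨_, h.zeroOn_mem i hi, ?_⟩
  ext e
  by_cases he : e ∈ s i
  · simp [he, zeroOn_of_mem he]
  · simp [he, zeroOn_of_notMem he, (hM.mem_topes_iff.1 h.tope).2 e]

/-- Flipping the signs of `T` on a block `s (k + 1) ∖ s k` keeps the conditions on `T`: with `T_i`
for `T` zeroed on `s i`, the flipped vector zeroed on `s i`, `i ≤ k`, is the composition
`T_{k+1} ∘ (-T_k) ∘ T_i`. -/
theorem IsFlagPrefix.flipOn (hM : M.Loopless) (h : M.IsFlagPrefix n s T) {k : ℕ} (hk : k < n) :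
    M.IsFlagPrefix n s (flipOn (s (k + 1) \ s k) T) := by
  have h0 := (hM.mem_topes_iff.1 h.tope).2
  have hsub := (h.covers k hk).subset
  have key : ∀ i ≤ n, zeroOn (s i) (OrientedMatroid.flipOn (s (k + 1) \ s k) T) ∈
      M.covectors := by
    intro i hi
    rcases le_or_gt i k with hik | hik
    · have hsub' := h.subset hik hk.le
      convert M.comp_mem _ (h.zeroOn_mem (k + 1) hk) _ (M.comp_mem _
        (M.neg_mem _ (h.zeroOn_mem k hk.le)) _ (h.zeroOn_mem i hi)) using 1
      funext e
      have := @hsub e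
      have := @hsub' e
      have := h0 e
      by_cases h1 : e ∈ s (k + 1) <;> by_cases h2 : e ∈ s k <;> by_cases h3 : e ∈ s i <;>
        simp_all [signComp, zeroOn, OrientedMatroid.flipOn]
    · convert h.zeroOn_mem i hi using 1
      have hsub' := h.subset hik hi
      funext e
      have := @hsub' e
      by_cases h1 : e ∈ s (k + 1) <;> by_cases h3 : e ∈ s i <;>
        simp_all [zeroOn, OrientedMatroid.flipOn]
  refine ⟨h.zero, h.covers, hM.mem_topes_iff.2 ⟨?_, fun e => ?_⟩, key⟩
  · have := key 0 (Nat.zero_le _)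
    rwa [h.zero, zeroOn_empty] at this
  · unfold OrientedMatroid.flipOn
    split_ifs <;> simp [h0 e]

theorem flagChain_mem_topeSpace (hM : M.Loopless) (hp : p ≤ n) :
    ∀ T, M.IsFlagPrefix n s T → flagChain s p T ∈ M.topeSpace := by
  induction p with
  | zero => exact fun T h => Finsupp.single_mem_supported ℤ 1 h.tope
  | succ p ih =>
    exact fun T h => sub_mem (ih (by omega) T h) (ih (by omega) _ (h.flipOn hM (by omega)))

theorem signOn_congr {B : Set E} {Y Y' : E → SignType} (h : ∀ e ∈ B, Y e = Y' e) :
    signOn B Y = signOn B Y' := by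
  funext j
  unfold signOn
  split_ifs with hj
  · rw [h j hj]
  · rfl

theorem IsFlagPrefix.flagCoeff_congr (hs : M.IsFlagPrefix p s T) {s' : ℕ → Set E}
    {T' : E → SignType} (h : ∀ i ≤ p, s' i = s i) (hT : ∀ e ∈ s p, T' e = T e) :
    flagCoeff s' T' p = flagCoeff s T p := by
  induction p with
  | zero => rfl
  | succ p ih =>
    rw [flagCoeff, flagCoeff, ih (hs.mono (Nat.le_succ p)) (fun i hi => h i (by omega))
      fun e he => hT e (hs.subset (Nat.le_succ p) le_rfl he), h p (by omega), h (p + 1) le_rfl,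
      signOn_congr fun e he => hT e he.1]

/-! ### Top coefficients of flag chains -/

theorem heavisideMonomial_union {A B : Finset E} (h : Disjoint A B) (T : E → SignType) :
    heavisideMonomial (A ∪ B) T = heavisideMonomial A T * heavisideMonomial B T :=
  Finset.prod_union h

theorem heavisideMonomial_congr {A : Finset E} {T T' : E → SignType} (h : ∀ e ∈ A, T e = T' e) :
    heavisideMonomial A T = heavisideMonomial A T' :=
  Finset.prod_congr rfl fun e he => by rw [h e he]

@[simp]
theorem heavisideMonomial_empty (T : E → SignType) : heavisideMonomial ∅ T = 1 := rfl

/-- The intersection of a finite set with a set. -/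
noncomputable def interSet (S : Finset E) (B : Set E) : Finset E :=
  S.filter (· ∈ B)

@[simp]
theorem mem_interSet {S : Finset E} {B : Set E} {e : E} : e ∈ interSet S B ↔ e ∈ S ∧ e ∈ B :=
  Finset.mem_filter

theorem interSet_eq_empty_iff {S : Finset E} {B : Set E} :
    interSet S B = ∅ ↔ ∀ e ∈ S, e ∉ B :=
  Finset.filter_eq_empty_iff

theorem card_interSet_add_card_interSet_compl (S : Finset E) (B : Set E) :
    (interSet S B).card + (interSet S Bᶜ).card = S.card := by
  unfold interSet
  convert Finset.card_filter_add_card_filter_not (s := S) (· ∈ B)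

/-- The difference of the monomial of `S ∩ B` at `T` and at `-T`. -/
noncomputable def blockDiff (B : Set E) (S : Finset E) (T : E → SignType) : ℤ :=
  heavisideMonomial (interSet S B) T - heavisideMonomial (interSet S B) (fun e => -T e)

theorem blockDiff_eq_zero {B : Set E} {S : Finset E} {T : E → SignType} (h : ∀ e ∈ S, e ∉ B) :
    blockDiff B S T = 0 := by
  rw [blockDiff, interSet_eq_empty_iff.2 h]
  simp

theorem heavisidePairing_flagChain (h0 : s 0 = ∅) (hs : ∀ i < p, s i ⊆ s (i + 1))
    (S : Finset E) (T : E → SignType) :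
    heavisidePairing S (flagChain s p T) =
      heavisideMonomial (interSet S (s p)ᶜ) T *
        ∏ i ∈ Finset.range p, blockDiff (s (i + 1) \ s i) S T := by
  induction p generalizing T with
  | zero =>
    have : interSet S (s 0)ᶜ = S := by
      ext e; simp [h0]
    simp [flagChain, this]
  | succ p ih =>
    have ih' := ih fun i hi => hs i (by omega)
    have hmono : ∀ i < p, s (i + 1) ⊆ s p := fun i hi =>
      subset_of_forall_subset_succ hs hi (Nat.le_succ p)
    have hsub := hs p (Nat.lt_succ_self p)
    have hsplit : interSet S (s p)ᶜ =
        interSet S (s (p + 1) \ s p) ∪ interSet S (s (p + 1))ᶜ := by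
      ext e
      have := @hsub e
      simp only [mem_interSet, Finset.mem_union, Set.mem_sdiff, Set.mem_compl_iff]
      tauto
    have hdisj : Disjoint (interSet S (s (p + 1) \ s p)) (interSet S (s (p + 1))ᶜ) := by
      rw [Finset.disjoint_left]
      intro e he he'
      exact (mem_interSet.1 he').2 (mem_interSet.1 he).2.1
    set T' := OrientedMatroid.flipOn (s (p + 1) \ s p) T with hT'
    have h1 : heavisideMonomial (interSet S (s (p + 1) \ s p)) T' =
        heavisideMonomial (interSet S (s (p + 1) \ s p)) (fun e => -T e) :=
      heavisideMonomial_congr fun e he => if_pos (mem_interSet.1 he).2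
    have h2 : heavisideMonomial (interSet S (s (p + 1))ᶜ) T' =
        heavisideMonomial (interSet S (s (p + 1))ᶜ) T :=
      heavisideMonomial_congr fun e he => if_neg fun h => (mem_interSet.1 he).2 h.1
    have h3 : ∏ i ∈ Finset.range p, blockDiff (s (i + 1) \ s i) S T' =
        ∏ i ∈ Finset.range p, blockDiff (s (i + 1) \ s i) S T := by
      refine Finset.prod_congr rfl fun i hi => ?_
      have hT : ∀ e ∈ interSet S (s (i + 1) \ s i), T' e = T e := fun e he =>
        if_neg fun h => h.2 (hmono _ (Finset.mem_range.1 hi) (mem_interSet.1 he).2.1)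
      rw [blockDiff, blockDiff, heavisideMonomial_congr hT,
        heavisideMonomial_congr fun e he => congrArg Neg.neg (hT e he)]
    rw [flagChain, map_sub, ih', ih', h3, hsplit, heavisideMonomial_union hdisj,
      heavisideMonomial_union hdisj, h1, h2, Finset.prod_range_succ, blockDiff]
    ring

theorem heavisidePairing_interSet_flagChain (h0 : s 0 = ∅) (hs : ∀ i < p, s i ⊆ s (i + 1))
    (S : Finset E) (T : E → SignType) :
    heavisidePairing (interSet S (s p)) (flagChain s p T) =
      ∏ i ∈ Finset.range p, blockDiff (s (i + 1) \ s i) S T := by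
  have h1 : interSet (interSet S (s p)) (s p)ᶜ = ∅ :=
    interSet_eq_empty_iff.2 fun e he h => h (mem_interSet.1 he).2
  rw [heavisidePairing_flagChain h0 hs, h1, heavisideMonomial_empty, one_mul]
  refine Finset.prod_congr rfl fun i hi => ?_
  have h2 : interSet (interSet S (s p)) (s (i + 1) \ s i) = interSet S (s (i + 1) \ s i) := by
    have hsub := subset_of_forall_subset_succ hs (Finset.mem_range.1 hi) le_rfl
    ext e
    have := @hsub e
    simp only [mem_interSet, Set.mem_sdiff]
    tauto
  rw [blockDiff, blockDiff, h2]

theorem heavisidePairing_flagChain_eq_mul (h0 : s 0 = ∅) (hs : ∀ i < p, s i ⊆ s (i + 1))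
    (S : Finset E) (T : E → SignType) :
    heavisidePairing S (flagChain s p T) =
      heavisideMonomial (interSet S (s p)ᶜ) T *
        heavisidePairing (interSet S (s p)) (flagChain s p T) := by
  rw [heavisidePairing_flagChain h0 hs, heavisidePairing_interSet_flagChain h0 hs]

theorem heavisidePairing_flagChain_succ (h0 : s 0 = ∅) (hs : ∀ i < p + 1, s i ⊆ s (i + 1))
    (S : Finset E) (T : E → SignType) :
    heavisidePairing S (flagChain s (p + 1) T) =
      heavisideMonomial (interSet S (s (p + 1))ᶜ) T *
        (heavisidePairing (interSet S (s p)) (flagChain s p T) *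
          blockDiff (s (p + 1) \ s p) S T) := by
  rw [heavisidePairing_flagChain h0 hs, Finset.prod_range_succ,
    heavisidePairing_interSet_flagChain h0 fun i hi => hs i (by omega)]

/-- A flag chain pairs to zero with monomials of low degree, since a monomial of degree less than
`p` misses one of the `p` blocks; in degree `p` its values are the coefficients of
`ε_{F,T,p}`. -/
theorem heavisidePairing_flagChain_le (h0 : s 0 = ∅) (hs : ∀ i < p, s i ⊆ s (i + 1))
    (T : E → SignType) (S : Finset E) :
    (S.card < p → heavisidePairing S (flagChain s p T) = 0) ∧
      (S.card = p → heavisidePairing S (flagChain s p T) = flagCoeff s T p S) := by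
  induction p generalizing S with
  | zero =>
    refine ⟨fun h => absurd h (Nat.not_lt_zero _), fun h => ?_⟩
    rw [Finset.card_eq_zero] at h
    subst h
    simp [flagChain, flagCoeff]
  | succ p ih =>
    have hs' : ∀ i < p, s i ⊆ s (i + 1) := fun i hi => hs i (by omega)
    have ih := ih hs'
    rw [heavisidePairing_flagChain_succ h0 hs]
    have hcard := card_interSet_add_card_interSet_compl S (s p)
    by_cases hR : (interSet S (s p)).card < p
    · rw [(ih _).1 hR]
      refine ⟨fun _ => by ring, fun hS => ?_⟩
      rw [flagCoeff, mulLinear_apply, zero_mul, mul_zero]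
      refine (Finset.sum_eq_zero fun j hj => ?_).symm
      unfold signOn
      split_ifs with hjB
      · have hfil : interSet (S.erase j) (s p) = interSet S (s p) := by
          ext e
          simp only [mem_interSet, Finset.mem_erase]
          constructor
          · tauto
          · rintro ⟨h1, h2⟩
            exact ⟨⟨fun h => hjB.2 (h ▸ h2), h1⟩, h2⟩
        rw [← (ih _).2 (by rw [Finset.card_erase_of_mem hj]; omega),
          heavisidePairing_flagChain_eq_mul h0 hs', hfil, (ih _).1 hR]
        ring
      · ring
    · rcases Nat.lt_trichotomy (interSet S (s p)ᶜ).card 1 with hQ | hQ | hQ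
      · have hSs : ∀ e ∈ S, e ∈ s p := by
          have := Finset.card_eq_zero.1 (Nat.lt_one_iff.1 hQ)
          simpa [interSet_eq_empty_iff] using this
        rw [blockDiff_eq_zero fun e he h => h.2 (hSs e he)]
        refine ⟨fun _ => by ring, fun _ => ?_⟩
        rw [flagCoeff, mulLinear_apply, mul_zero, mul_zero]
        refine (Finset.sum_eq_zero fun j hj => ?_).symm
        rw [signOn, if_neg fun h => h.2 (hSs j hj), zero_mul]
      · refine ⟨fun hS => by omega, fun hS => ?_⟩
        obtain ⟨j, hj⟩ := Finset.card_eq_one.1 hQ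
        have hjS : j ∈ S ∧ j ∉ s p := by
          have : j ∈ interSet S (s p)ᶜ := hj ▸ Finset.mem_singleton_self j
          simpa using this
        have honly : ∀ e ∈ S, e ∉ s p → e = j := fun e he he' => by
          have : e ∈ interSet S (s p)ᶜ := by simp [he, he']
          rwa [hj, Finset.mem_singleton] at this
        have hR' : interSet S (s p) = S.erase j := by
          ext e
          simp only [mem_interSet, Finset.mem_erase]
          constructor
          · rintro ⟨h1, h2⟩
            exact ⟨fun h => hjS.2 (h ▸ h2), h1⟩
          · rintro ⟨h1, h2⟩
            exact ⟨h2, by_contra fun h => h1 (honly e h2 h)⟩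
        have hsum : flagCoeff s T (p + 1) S =
            signOn (s (p + 1) \ s p) T j * flagCoeff s T p (S.erase j) := by
          rw [flagCoeff, mulLinear_apply, Finset.sum_eq_single_of_mem j hjS.1]
          intro e he hej
          rw [signOn, if_neg fun h => hej (honly e he h.2), zero_mul]
        rw [hsum, hR', (ih _).2 (by rw [Finset.card_erase_of_mem hjS.1]; omega)]
        by_cases hjs : j ∈ s (p + 1)
        · have h1 : interSet S (s (p + 1))ᶜ = ∅ := by
            refine interSet_eq_empty_iff.2 fun e he h => h ?_
            by_cases hep : e ∈ s p
            · exact hs p (by omega) hep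
            · rwa [honly e he hep]
          have h2 : interSet S (s (p + 1) \ s p) = {j} := by
            ext e
            simp only [mem_interSet, Finset.mem_singleton]
            constructor
            · rintro ⟨h3, h4⟩
              exact honly e h3 h4.2
            · rintro rfl
              exact ⟨hjS.1, hjs, hjS.2⟩
          rw [h1, heavisideMonomial_empty, blockDiff, h2, signOn, if_pos ⟨hjs, hjS.2⟩]
          have h3 : heavisideMonomial {j} T - heavisideMonomial {j} (fun e => -T e) =
              ((T j : SignType) : ℤ) := by
            simp only [heavisideMonomial, Finset.prod_singleton]
            have hcase : T j = 0 ∨ T j = 1 ∨ T j = -1 := by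
              generalize T j = x; revert x; decide
            rcases hcase with h | h | h <;> simp [h]
          rw [h3]
          ring
        · rw [blockDiff_eq_zero fun e he (h : e ∈ s (p + 1) \ s p) =>
            hjs (honly e he h.2 ▸ h.1), signOn,
            if_neg fun h => hjs h.1]
          ring
      · exact ⟨fun hS => by omega, fun hS => by omega⟩

theorem IsFlagPrefix.flagChain_mem_dualFiltration (hM : M.Loopless) (h : M.IsFlagPrefix p s T) :
    flagChain s p T ∈ M.dualFiltration p :=
  mem_dualFiltration_iff.2 ⟨flagChain_mem_topeSpace hM le_rfl T h, fun S hS =>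
    (heavisidePairing_flagChain_le h.zero h.subset_succ T S).1 hS⟩

theorem flagCoeff_eq_zero {S : Finset E} (hS : S.card ≠ p) : flagCoeff s T p S = 0 := by
  induction p generalizing S with
  | zero => exact if_neg fun h => hS (Finset.card_eq_zero.2 h)
  | succ p ih =>
    refine Finset.sum_eq_zero fun j hj => ?_
    rw [ih, mul_zero]
    have := Finset.card_erase_add_one hj
    omega

theorem IsFlagPrefix.topCoeff_flagChain (h : M.IsFlagPrefix p s T) :
    topCoeff p (flagChain s p T) = flagCoeff s T p := by
  funext S
  rw [topCoeff_apply]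
  split_ifs with hS
  · exact (heavisidePairing_flagChain_le h.zero h.subset_succ T S).2 hS
  · exact (flagCoeff_eq_zero hS).symm

theorem IsFlagPrefix.flagCoeff_mem_dualCoeff [Fintype E] (hM : M.Loopless)
    (h : M.IsFlagPrefix p s T) : flagCoeff s T p ∈ M.dualCoeff :=
  h.topCoeff_flagChain ▸ topCoeff_mem_dualCoeff hM (h.flagChain_mem_dualFiltration hM)

theorem IsFlagPrefix.cl_eq_of_flagCoeff_ne_zero [Fintype E] (hM : M.Loopless)
    (h : M.IsFlagPrefix p s T) {S : Finset E} (hS : flagCoeff s T p S ≠ 0) :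
    M.cl (S : Set E) = s p := by
  induction p generalizing S with
  | zero =>
    have : S = ∅ := by
      by_contra h'
      exact hS (if_neg h')
    rw [this, Finset.coe_empty, hM.cl_empty, h.zero]
  | succ p ih =>
    obtain ⟨j, hj, hne⟩ := Finset.exists_ne_zero_of_sum_ne_zero hS
    have hjB : j ∈ s (p + 1) \ s p := by
      by_contra hjB
      exact hne (by rw [signOn, if_neg hjB, zero_mul])
    have hcl := ih (h.mono (Nat.le_succ p)) (right_ne_zero_of_mul hne)
    have hcov := h.covers p (Nat.lt_succ_self p)
    refine hcov.2 _ (isFlat_cl _) ⟨?_, fun hsub => ?_⟩ ?_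
    · rw [← hcl]
      exact cl_mono (by simp)
    · exact hjB.2 (hsub (subset_cl _ hj))
    · refine (h.isFlat hM le_rfl).cl_subset fun e he => ?_
      by_cases hej : e = j
      · exact hej ▸ hjB.1
      · exact hcov.subset (hcl ▸ subset_cl _ (by simpa [hej] using he))

/-! ### Extending initial segments of flags -/

/-- The flag `s 0, …, s n` is prolonged by `G`; the signs of the new tope on `G ∖ s n` are those
of a given covector with zero set `s n`. -/
theorem IsFlagPrefix.exists_snoc (hM : M.Loopless) (h : M.IsFlagPrefix n s T) {G : Set E}
    (hG : M.IsFlat G) (hcov : M.Covers (s n) G) {Y : E → SignType} (hY : Y ∈ M.covectors)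
    (hY0 : ∀ e, Y e = 0 ↔ e ∈ s n) :
    ∃ s' T', M.IsFlagPrefix (n + 1) s' T' ∧ (∀ i ≤ n, s' i = s i) ∧ s' (n + 1) = G ∧
      (∀ e ∈ s n, T' e = T e) ∧ ∀ e ∈ G \ s n, T' e = Y e := by
  obtain ⟨W, hW, hWG⟩ := hG
  have hW0 : ∀ e, W e = 0 ↔ e ∈ G := fun e => by rw [hWG]; rfl
  have hT0 := (hM.mem_topes_iff.1 h.tope).2
  set s' : ℕ → Set E := fun i => if i ≤ n then s i else G with hs'
  have hs'1 : ∀ i ≤ n, s' i = s i := fun i hi => if_pos hi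
  have hs'2 : s' (n + 1) = G := if_neg (by omega)
  set T' := signComp W (signComp Y T) with hT'
  have hT'0 : ∀ e, T' e ≠ 0 := fun e he =>
    hT0 e (signComp_eq_zero.1 (signComp_eq_zero.1 he).2).2
  have key : ∀ i ≤ n + 1, zeroOn (s' i) T' ∈ M.covectors := by
    intro i hi
    rcases Nat.lt_or_ge n i with hni | hni
    · obtain rfl : i = n + 1 := by omega
      rw [hs'2]
      convert hW using 1
      funext e
      by_cases he : e ∈ G
      · rw [zeroOn_of_mem he, (hW0 e).2 he]
      · rw [zeroOn_of_notMem he, hT', signComp, if_neg fun h => he ((hW0 e).1 h)]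
    · rw [hs'1 i hni]
      convert M.comp_mem _ hW _ (M.comp_mem _ hY _ (h.zeroOn_mem i hni)) using 1
      funext e
      by_cases he : e ∈ s i
      · have he' := h.subset hni le_rfl he
        simp [signComp, zeroOn_of_mem he, (hW0 e).2 (hcov.subset he'), (hY0 e).2 he']
      · simp [hT', signComp, zeroOn_of_notMem he]
  refine ⟨s', T', ⟨(hs'1 0 (Nat.zero_le _)).trans h.zero, fun i hi => ?_,
    hM.mem_topes_iff.2 ⟨?_, hT'0⟩, key⟩, hs'1, hs'2, fun e he => ?_, fun e he => ?_⟩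
  · rcases Nat.lt_succ_iff_lt_or_eq.1 hi with h' | rfl
    · rw [hs'1 i h'.le, hs'1 (i + 1) h']
      exact h.covers i h'
    · rw [hs'1 i le_rfl, hs'2]
      exact hcov
  · have := key 0 (Nat.zero_le _)
    rwa [hs'1 0 (Nat.zero_le _), h.zero, zeroOn_empty] at this
  · simp [hT', signComp, (hW0 e).2 (hcov.subset he), (hY0 e).2 he]
  · have : Y e ≠ 0 := fun h' => he.2 ((hY0 e).1 h')
    simp [hT', signComp, (hW0 e).2 he.1, this]

theorem isFlat_univ : M.IsFlat Set.univ :=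
  ⟨_, M.zero_mem, by simp⟩

theorem exists_covers [Finite E] {H : Set E} (hH : H ≠ Set.univ) :
    ∃ G, M.IsFlat G ∧ M.Covers H G := by
  obtain ⟨G, hG⟩ := Set.Finite.exists_minimal (Set.toFinite {G | M.IsFlat G ∧ H ⊂ G})
    ⟨Set.univ, isFlat_univ, Set.ssubset_univ_iff.2 hH⟩
  exact ⟨G, hG.1.1, hG.1.2, fun K hK hHK hKG => hKG.antisymm (hG.2 ⟨hK, hHK⟩ hKG)⟩

theorem IsFlagPrefix.exists_complete [Finite E] (hM : M.Loopless) (h : M.IsFlagPrefix p s T) :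
    ∃ n s' T', p ≤ n ∧ M.IsFlagPrefix n s' T' ∧ s' n = Set.univ ∧ (∀ i ≤ p, s' i = s i) ∧
      ∀ e ∈ s p, T' e = T e := by
  induction hm : (s p)ᶜ.ncard using Nat.strong_induction_on generalizing p s T with
  | _ m ih =>
    by_cases hp : s p = Set.univ
    · exact ⟨p, s, T, le_rfl, h, hp, fun _ _ => rfl, fun _ _ => rfl⟩
    obtain ⟨G, hG, hcov⟩ := M.exists_covers hp
    obtain ⟨Y, hY, hYs⟩ := h.isFlat hM le_rfl
    obtain ⟨s₁, T₁, h₁, hs₁, hsG, hT₁, -⟩ := h.exists_snoc hM hG hcov hY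
      fun e => by rw [hYs]; rfl
    obtain ⟨n, s₂, T₂, hn, h₂, hu, hs₂, hT₂⟩ := ih (s₁ (p + 1))ᶜ.ncard
      (by
        rw [← hm, hsG]
        exact Set.ncard_lt_ncard (compl_lt_compl_iff_lt.2 hcov.1) (Set.toFinite _)) h₁ rfl
    refine ⟨n, s₂, T₂, by omega, h₂, hu, fun i hi => ?_, fun e he => ?_⟩
    · rw [hs₂ i (by omega), hs₁ i hi]
    · rw [hT₂ e (by rw [hsG]; exact hcov.subset he), hT₁ e he]

end Prefix

/-! ### The dual Cordovil module is spanned by flag elements -/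

section Span

open scoped Classical

variable {E : Type*} {M : OrientedMatroid E}

/-- The span of the coefficient families of the elements `ε_{F,T,p}` with `F_p = G`. -/
noncomputable def flagSpan (M : OrientedMatroid E) (p : ℕ) (G : Set E) :
    Submodule ℤ (Finset E → ℤ) :=
  Submodule.span ℤ {a | ∃ s T, M.IsFlagPrefix p s T ∧ s p = G ∧ a = flagCoeff s T p}

theorem mulLinear_mem_flagSpan (hM : M.Loopless) {p : ℕ} {H G : Set E} (hG : M.IsFlat G)
    (hcov : M.Covers H G) {Y : E → SignType} (hY : Y ∈ M.covectors)
    (hY0 : ∀ e, Y e = 0 ↔ e ∈ H) {a : Finset E → ℤ} (ha : a ∈ M.flagSpan p H) :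
    mulLinear (signOn (G \ H) Y) a ∈ M.flagSpan (p + 1) G := by
  suffices M.flagSpan p H ≤ (M.flagSpan (p + 1) G).comap (mulLinear (signOn (G \ H) Y)) from
    this ha
  refine Submodule.span_le.2 ?_
  rintro _ ⟨s, T, h, rfl, rfl⟩
  obtain ⟨s', T', h', hs', hsG, hT', hTY⟩ := h.exists_snoc hM hG hcov hY hY0
  refine Submodule.subset_span ⟨s', T', h', hsG, ?_⟩
  rw [flagCoeff, h.flagCoeff_congr hs' hT', hsG, hs' p le_rfl, signOn_congr hTY]

variable [Fintype E]

theorem flagSpan_le_dualCoeff (hM : M.Loopless) (p : ℕ) (G : Set E) :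
    M.flagSpan p G ≤ M.dualCoeff := by
  refine Submodule.span_le.2 ?_
  rintro _ ⟨s, T, h, -, rfl⟩
  exact h.flagCoeff_mem_dualCoeff hM

theorem cl_eq_of_mem_flagSpan (hM : M.Loopless) {p : ℕ} {G : Set E} {a : Finset E → ℤ}
    (ha : a ∈ M.flagSpan p G) {S : Finset E} (hS : a S ≠ 0) : M.cl (S : Set E) = G := by
  by_contra hcl
  refine hS ?_
  have hle : M.flagSpan p G ≤ LinearMap.ker (LinearMap.proj S : (Finset E → ℤ) →ₗ[ℤ] ℤ) := by
    refine Submodule.span_le.2 ?_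
    rintro _ ⟨s, T, h, rfl, rfl⟩
    by_contra h0
    exact hcl (h.cl_eq_of_flagCoeff_ne_zero hM h0)
  exact hle ha

/-- The inductive step: the coefficients of sets containing a fixed element `e` of `G`, with `e`
removed, form a family in degree `p`, which is split according to the closures `H` of the sets.
Multiplying the part at `H` by the linear form of a covector with zero set `H` gives a combination
of flag elements with the same coefficients at all sets containing `e`. These coefficients
determine the family. -/
theorem mem_flagSpan (hM : M.Loopless) (p : ℕ) (G : Set E) (a : Finset E → ℤ)
    (ha : a ∈ M.dualCoeff) (hcard : ∀ S, a S ≠ 0 → S.card = p)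
    (hcl : ∀ S, a S ≠ 0 → M.cl (S : Set E) = G) : a ∈ M.flagSpan p G := by
  induction p generalizing G a with
  | zero =>
    by_cases ha0 : a ∅ = 0
    · have : a = 0 := by
        funext S
        by_contra hS
        have := Finset.card_eq_zero.1 (hcard S hS)
        subst this
        exact hS ha0
      rw [this]
      exact Submodule.zero_mem _
    · obtain ⟨T, hT⟩ := hM.exists_tope
      have hG := hcl ∅ ha0
      rw [Finset.coe_empty, hM.cl_empty] at hG
      have hpre : M.IsFlagPrefix 0 (fun _ => ∅) T :=
        ⟨rfl, fun i hi => absurd hi (Nat.not_lt_zero i), hT, fun i _ => by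
          rw [zeroOn_empty]; exact hT.1⟩
      have : a = a ∅ • flagCoeff (fun _ => ∅) T 0 := by
        funext S
        by_cases hS : S = ∅
        · simp [flagCoeff, hS]
        · simp only [Pi.smul_apply, flagCoeff, if_neg hS, smul_zero]
          by_contra h
          exact hS (Finset.card_eq_zero.1 (hcard S h))
      rw [this]
      exact Submodule.smul_mem _ _ (Submodule.subset_span ⟨_, T, hpre, hG, rfl⟩)
  | succ p ih =>
    by_cases ha0 : a = 0
    · rw [ha0]
      exact Submodule.zero_mem _
    obtain ⟨S₀, hS₀⟩ := Function.ne_iff.1 ha0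
    obtain ⟨e, heS₀⟩ : S₀.Nonempty := Finset.card_pos.1 (by rw [hcard S₀ hS₀]; omega)
    have heG : e ∈ G := hcl S₀ hS₀ ▸ subset_cl _ heS₀
    have hG : M.IsFlat G := hcl S₀ hS₀ ▸ isFlat_cl _
    set b := contractCoeff {e} a with hb
    have hbS : ∀ S, b S ≠ 0 → e ∉ S ∧ a (insert e S) ≠ 0 := by
      intro S hS
      simp only [hb, contractCoeff, Finset.disjoint_singleton_left, ne_eq, ite_eq_right_iff,
        Classical.not_imp] at hS
      rwa [← Finset.insert_eq] at hS
    choose Y hY hY0 using fun H : Set E => M.exists_covector_zeroSet_eq_cl H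
    -- Every flat `H` that occurs is covered by `G` and does not contain `e`.
    have hH : ∀ H S, M.flatPart H b S ≠ 0 →
        M.Covers H G ∧ e ∉ H ∧ M.cl H = H ∧ S.card = p := by
      intro H S hS
      simp only [flatPart, ne_eq, ite_eq_right_iff, Classical.not_imp] at hS
      obtain ⟨rfl, hS⟩ := hS
      obtain ⟨heS, haS⟩ := hbS S hS
      have hclS := hcl _ haS
      rw [Finset.coe_insert] at hclS
      have heH : e ∉ M.cl (S : Set E) := by
        have := indep_of_ne_zero ha haS e (by simp)
        rwa [Finset.coe_insert, Set.insert_sdiff_self_of_notMem (by simpa using heS)] at this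
      refine ⟨⟨⟨hclS ▸ cl_mono (Set.subset_insert _ _), fun h => heH (h heG)⟩, ?_⟩, heH, cl_cl _,
        ?_⟩
      · intro K hK hHK hKG
        refine hKG.antisymm ?_
        obtain ⟨f, hfK, hf⟩ := Set.exists_of_ssubset hHK
        have hSK : (S : Set E) ⊆ K := (subset_cl _).trans hHK.1
        have heK : e ∈ K := hK.cl_subset (Set.insert_subset hfK hSK)
          (cl_exchange (hclS ▸ hKG hfK) hf)
        exact hclS ▸ hK.cl_subset (Set.insert_subset heK hSK)
      · have := hcard _ haS
        rw [Finset.card_insert_of_notMem heS] at this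
        omega
    set a' := ∑ H : Set E, ((Y H e : SignType) : ℤ) •
      mulLinear (signOn (G \ H) (Y H)) (M.flatPart H b) with ha'
    have ha'span : a' ∈ M.flagSpan (p + 1) G := by
      refine Submodule.sum_mem _ fun H _ => Submodule.smul_mem _ _ ?_
      by_cases h0 : M.flatPart H b = 0
      · rw [h0, map_zero]
        exact Submodule.zero_mem _
      obtain ⟨S, hS⟩ := Function.ne_iff.1 h0
      obtain ⟨hcov, -, hclH, -⟩ := hH H S hS
      refine mulLinear_mem_flagSpan hM hG hcov (hY H) (fun f => (hY0 H f).trans (by rw [hclH])) ?_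
      refine ih H _ (flatPart_mem_dualCoeff (contractCoeff_mem_dualCoeff ha e) H)
        (fun R hR => (hH H R hR).2.2.2) fun R hR => ?_
      by_contra h
      exact hR (if_neg h)
    have hdiff : a - a' = 0 := by
      refine eq_zero_of_forall_mem_eq_zero
        (sub_mem ha (flagSpan_le_dualCoeff hM _ _ ha'span)) (G := G) (fun S hS => ?_) heG ?_
      · by_cases h1 : a S = 0
        · refine cl_eq_of_mem_flagSpan hM ha'span (S := S) fun h2 => hS ?_
          rw [Pi.sub_apply, h1, h2, sub_zero]
        · exact hcl S h1
      · intro S heS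
        have hterm : ∀ H : Set E, ((Y H e : SignType) : ℤ) *
            mulLinear (signOn (G \ H) (Y H)) (M.flatPart H b) S =
              M.flatPart H b (S.erase e) := by
          intro H
          rw [mulLinear_apply, Finset.sum_eq_single_of_mem e heS]
          · by_cases h0 : M.flatPart H b (S.erase e) = 0
            · rw [h0, mul_zero, mul_zero]
            obtain ⟨-, heH, hclH, -⟩ := hH H _ h0
            rw [signOn, if_pos ⟨heG, heH⟩, ← mul_assoc]
            have hYe : Y H e ≠ 0 := fun h => heH (hclH ▸ (hY0 H e).1 h)
            have hsq : ((Y H e : SignType) : ℤ) * ((Y H e : SignType) : ℤ) = 1 := by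
              revert hYe; generalize Y H e = x; revert x; decide
            rw [hsq, one_mul]
          · intro j _ hje
            suffices M.flatPart H b (S.erase j) = 0 by rw [this, mul_zero]
            by_contra h0
            have hb0 : b (S.erase j) ≠ 0 := fun h => h0 (by rw [flatPart, h, ite_self])
            exact (hbS _ hb0).1 (Finset.mem_erase.2 ⟨Ne.symm hje, heS⟩)
        have hsum : a' S = b (S.erase e) := by
          rw [ha', Finset.sum_apply, ← congrFun (M.sum_flatPart b) (S.erase e), Finset.sum_apply]
          exact Finset.sum_congr rfl fun H _ => hterm H
        rw [Pi.sub_apply, hsum, hb, contractCoeff, if_pos (by simp), ← Finset.insert_eq,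
          Finset.insert_erase heS, sub_self]
    rw [sub_eq_zero.1 hdiff]
    exact ha'span

end Span

/-! ### Complete flags and the map `ã_p` -/

section Flags

open scoped Classical

variable {E : Type*} {M : OrientedMatroid E}

/-- The members of a flag, indexed by the natural numbers; the last member is repeated. -/
def FlatFlag.toSeq (F : M.FlatFlag) (i : ℕ) : Set E :=
  F.flat ⟨min i F.length, by omega⟩

theorem FlatFlag.toSeq_of_le (F : M.FlatFlag) {i : ℕ} (hi : i ≤ F.length) :
    F.toSeq i = F.flat ⟨i, by omega⟩ := by
  simp [toSeq, hi]

theorem FlatFlag.block_eq (F : M.FlatFlag) (i : Fin F.length) :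
    F.block i = F.toSeq (i + 1) \ F.toSeq i := by
  rw [F.toSeq_of_le (i := i + 1) i.2, F.toSeq_of_le i.2.le]
  rfl

theorem FlatFlag.IsComplete.isFlagPrefix {F : M.FlatFlag} (hF : F.IsComplete)
    {T : E → SignType} (hT : T ∈ M.flagTopes F) : M.IsFlagPrefix F.length F.toSeq T := by
  rw [mem_flagTopes_iff] at hT
  refine ⟨?_, fun i hi => ?_, hT.1, fun i _ => hT.2 _⟩
  · rw [F.toSeq_of_le (Nat.zero_le _)]
    exact F.flat_first
  · rw [F.toSeq_of_le hi.le, F.toSeq_of_le (i := i + 1) hi]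
    exact ⟨F.strictMono (Fin.mk_lt_mk.2 (Nat.lt_succ_self i)), fun K => hF ⟨i, hi⟩ K⟩

theorem IsFlagPrefix.exists_flatFlag {n : ℕ} {s : ℕ → Set E} {T : E → SignType}
    (hM : M.Loopless) (h : M.IsFlagPrefix n s T) (hn : s n = Set.univ) :
    ∃ F : M.FlatFlag, F.IsComplete ∧ F.length = n ∧ T ∈ M.flagTopes F ∧
      ∀ i ≤ n, F.toSeq i = s i := by
  let F : M.FlatFlag :=
    { length := n
      flat := fun i => s i
      isFlat := fun i => h.isFlat hM (Nat.le_of_lt_succ i.2)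
      strictMono := Fin.strictMono_iff_lt_succ.2 fun i => (h.covers i i.2).1
      flat_first := h.zero
      flat_last := hn }
  refine ⟨F, fun i K => (h.covers i i.2).2 K, rfl, mem_flagTopes_iff.2
    ⟨h.tope, fun i => h.zeroOn_mem i (Nat.le_of_lt_succ i.2)⟩, fun i hi => ?_⟩
  exact F.toSeq_of_le hi

theorem filter_lt_succ {n p : ℕ} (hp : p < n) :
    Finset.univ.filter (fun i : Fin n => (i : ℕ) < p + 1) =
      insert ⟨p, hp⟩ (Finset.univ.filter fun i : Fin n => (i : ℕ) < p) := by
  ext i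
  simp only [Finset.mem_filter, Finset.mem_univ, true_and, Finset.mem_insert, Fin.ext_iff]
  omega

theorem prefixChain_eq (F : M.FlatFlag) {p : ℕ} (hp : p ≤ F.length) (T : E → SignType) :
    prefixChain F T p = flagChain F.toSeq p T := by
  induction p generalizing T with
  | zero =>
    have : flipBlocks F T ∅ = T := by
      funext e
      simp [flipBlocks]
    simp [prefixChain, flagChain, this]
  | succ p ih =>
    have hnot : (⟨p, hp⟩ : Fin F.length) ∉
        Finset.univ.filter fun i : Fin F.length => (i : ℕ) < p := by simp
    rw [flagChain, ← ih (by omega), ← ih (by omega), prefixChain, filter_lt_succ hp,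
      Finset.sum_powerset_insert hnot, sub_eq_add_neg, prefixChain, prefixChain,
      ← Finset.sum_neg_distrib]
    congr 1
    refine Finset.sum_congr rfl fun A hA => ?_
    have hpA : (⟨p, hp⟩ : Fin F.length) ∉ A := fun h => hnot (Finset.mem_powerset.1 hA h)
    rw [Finset.card_insert_of_notMem hpA, pow_succ, mul_neg_one, Finsupp.single_neg]
    congr 2
    funext e
    have hB : F.toSeq (p + 1) \ F.toSeq p = F.block ⟨p, hp⟩ := (F.block_eq ⟨p, hp⟩).symm
    rw [hB]
    simp only [flipBlocks, flipOn, Finset.mem_insert, exists_eq_or_imp]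
    by_cases h1 : e ∈ F.block ⟨p, hp⟩
    · have h2 : ¬ ∃ i ∈ A, e ∈ F.block i := by
        rintro ⟨i, hi, hei⟩
        exact hpA (F.block_index_unique h1 hei ▸ hi)
      simp [h1, h2]
    · simp [h1]

theorem sfCoeff_prefixElement [Fintype E] (F : M.FlatFlag) {p : ℕ} (hp : p ≤ F.length)
    (T : E → SignType) (S : Finset E) :
    sfCoeff S (prefixElement F T p) = flagCoeff F.toSeq T p S := by
  induction p generalizing S with
  | zero => simp [prefixElement, flagCoeff, sfCoeff_one]
  | succ p ih =>
    have hnot : (⟨p, hp⟩ : Fin F.length) ∉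
        Finset.univ.filter fun i : Fin F.length => (i : ℕ) < p := by simp
    rw [prefixElement, filter_lt_succ hp, Finset.prod_insert hnot, mul_comm, Finset.mul_sum,
      map_sum, flagCoeff, mulLinear_apply, F.block_eq]
    simp only [mul_smul_comm, map_zsmul, smul_eq_mul, sfCoeff_mul_X]
    simp only [mul_ite, mul_zero]
    rw [← Finset.sum_filter, Finset.filter_filter]
    simp only [signOn, ite_mul, zero_mul]
    rw [← Finset.sum_filter]
    refine Finset.sum_congr ?_ fun j _ => ?_
    · ext j
      simp [and_comm]
    · rw [← ih (by omega)]
      rfl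

theorem prefixChain_mem_dualFiltration (hM : M.Loopless) {F : M.FlatFlag} (hF : F.IsComplete)
    {p : ℕ} (hp : p ≤ F.length) {T : E → SignType} (hT : T ∈ M.flagTopes F) :
    prefixChain F T p ∈ M.dualFiltration p :=
  prefixChain_eq F hp T ▸ ((hF.isFlagPrefix hT).mono hp).flagChain_mem_dualFiltration hM

/-- The span of the prefix chains `γ_{F,T,p}`. -/
noncomputable def prefixSpan (M : OrientedMatroid E) (p : ℕ) :
    Submodule ℤ ((E → SignType) →₀ ℤ) :=
  Submodule.span ℤ {γ | ∃ F : M.FlatFlag, F.IsComplete ∧ p ≤ F.length ∧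
    ∃ T ∈ M.flagTopes F, γ = prefixChain F T p}

theorem prefixSpan_le_dualFiltration (hM : M.Loopless) (p : ℕ) :
    M.prefixSpan p ≤ M.dualFiltration p := by
  refine Submodule.span_le.2 ?_
  rintro _ ⟨F, hF, hp, T, hT, rfl⟩
  exact prefixChain_mem_dualFiltration hM hF hp hT

/-- A prefix chain for `p + 1` is the difference of two prefix chains for `p`, whose topes differ
by the signs on one block. -/
theorem prefixSpan_succ_le (hM : M.Loopless) (p : ℕ) : M.prefixSpan (p + 1) ≤ M.prefixSpan p := by
  refine Submodule.span_le.2 ?_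
  rintro _ ⟨F, hF, hp, T, hT, rfl⟩
  have hpre := (hF.isFlagPrefix hT).flipOn hM hp
  have hT' : flipOn (F.toSeq (p + 1) \ F.toSeq p) T ∈ M.flagTopes F :=
    mem_flagTopes_iff.2 ⟨hpre.tope, fun i => by
      have h := hpre.zeroOn_mem i (Nat.le_of_lt_succ i.2)
      rwa [F.toSeq_of_le (i := i) (Nat.le_of_lt_succ i.2)] at h⟩
  rw [prefixChain_eq F hp, flagChain, ← prefixChain_eq F (by omega),
    ← prefixChain_eq F (by omega)]
  exact sub_mem (Submodule.subset_span ⟨F, hF, by omega, T, hT, rfl⟩)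
    (Submodule.subset_span ⟨F, hF, by omega, _, hT', rfl⟩)

variable [Fintype E]

theorem sfEquiv_prefixElement (F : M.FlatFlag) {p : ℕ} (hp : p ≤ F.length)
    (T : E → SignType) : sfEquiv E (prefixElement F T p) = flagCoeff F.toSeq T p :=
  funext fun S => sfCoeff_prefixElement F hp T S

theorem topCoeff_prefixChain {F : M.FlatFlag} (hF : F.IsComplete)
    {p : ℕ} (hp : p ≤ F.length) {T : E → SignType} (hT : T ∈ M.flagTopes F) :
    topCoeff p (prefixChain F T p) = sfEquiv E (prefixElement F T p) := by
  rw [prefixChain_eq F hp, ((hF.isFlagPrefix hT).mono hp).topCoeff_flagChain,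
    sfEquiv_prefixElement F hp]

theorem isPrefixMap_symbolMap (hM : M.Loopless) (p : ℕ) : M.IsPrefixMap p (symbolMap hM p) := by
  intro F hF hp T hT
  refine ⟨prefixChain_mem_dualFiltration hM hF hp hT, ?_⟩
  rw [symbolMap_apply, topCoeff_prefixChain hF hp hT, LinearEquiv.symm_apply_apply]

/-- Every element of `𝒜_p` is the image of a combination of prefix chains. -/
theorem exists_mem_prefixSpan (hM : M.Loopless) {p : ℕ} {f : SFSym E}
    (hf : f ∈ M.dualCordovil p) : ∃ γ ∈ M.prefixSpan p, topCoeff p γ = sfEquiv E f := by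
  obtain ⟨hcard, hdual⟩ := mem_dualCordovil_iff.1 hf
  suffices sfEquiv E f ∈ (M.prefixSpan p).map (topCoeff p) from this
  rw [← M.sum_flatPart (sfEquiv E f)]
  refine Submodule.sum_mem _ fun G _ => ?_
  have hmem : M.flatPart G (sfEquiv E f) ∈ M.flagSpan p G := by
    refine mem_flagSpan hM p G _ (flatPart_mem_dualCoeff hdual G) (fun S hS => ?_) fun S hS => ?_
    · by_contra h
      exact hS (by rw [flatPart, sfEquiv_apply, hcard S h, ite_self])
    · by_contra h
      exact hS (if_neg h)
  refine (Submodule.span_le.2 ?_ : M.flagSpan p G ≤ _) hmem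
  rintro _ ⟨s, T, h, -, rfl⟩
  obtain ⟨n, s', T', hpn, h', hu, hs', hT'⟩ := h.exists_complete hM
  obtain ⟨F, hF, rfl, hTF, hFs⟩ := h'.exists_flatFlag hM hu
  refine ⟨_, Submodule.subset_span ⟨F, hF, hpn, T', hTF, rfl⟩, ?_⟩
  rw [topCoeff_prefixChain hF hpn hTF, sfEquiv_prefixElement F hpn]
  exact h.flagCoeff_congr (fun i hi => (hFs i (hi.trans hpn)).trans (hs' i hi)) hT'

theorem symbolMap_surjective (hM : M.Loopless) (p : ℕ) :
    Function.Surjective (symbolMap hM p) := by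
  intro f
  obtain ⟨γ, hγ, h⟩ := exists_mem_prefixSpan hM f.2
  refine ⟨⟨γ, prefixSpan_le_dualFiltration hM p hγ⟩, Subtype.ext ?_⟩
  rw [symbolMap_apply, h, LinearEquiv.symm_apply_apply]

/-- Prefix chains span `𝒫_p`: modulo `𝒫_{p+1}` because flag elements span `𝒜_p`, and then by
descending induction, since `𝒫_p` vanishes for large `p`. -/
theorem dualFiltration_eq_prefixSpan (hM : M.Loopless) (p : ℕ) :
    M.dualFiltration p = M.prefixSpan p := by
  refine le_antisymm ?_ (prefixSpan_le_dualFiltration hM p)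
  rcases le_or_gt p (Fintype.card E + 1) with hp | hp
  · induction hp using Nat.decreasingInduction with
    | self =>
      rw [hM.dualFiltration_eq_bot]
      exact bot_le
    | of_succ p _ ih =>
      intro γ hγ
      obtain ⟨γ', hγ', h⟩ := exists_mem_prefixSpan hM (symbolMap hM p ⟨γ, hγ⟩).2
      rw [symbolMap_apply, LinearEquiv.apply_symm_apply] at h
      have hker : γ - γ' ∈ M.dualFiltration (p + 1) := by
        refine (symbolMap_eq_zero_iff hM
          ⟨γ - γ', sub_mem hγ (prefixSpan_le_dualFiltration hM p hγ')⟩).1 (Subtype.ext ?_)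
        rw [symbolMap_apply, map_sub, h, sub_self, map_zero]
        rfl
      rw [← sub_add_cancel γ γ']
      exact add_mem (prefixSpan_succ_le hM p (ih hker)) hγ'
  · refine (dualFiltration_anti hp.le).trans ?_
    rw [hM.dualFiltration_eq_bot]
    exact bot_le

theorem IsPrefixMap.eq_symbolMap (hM : M.Loopless) {p : ℕ}
    {b : M.dualFiltration p →ₗ[ℤ] M.dualCordovil p} (hb : M.IsPrefixMap p b) :
    b = symbolMap hM p := by
  have hle : M.prefixSpan p ≤
      (LinearMap.eqLocus b (symbolMap hM p)).map (M.dualFiltration p).subtype := by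
    refine Submodule.span_le.2 ?_
    rintro _ ⟨F, hF, hp, T, hT, rfl⟩
    obtain ⟨h1, h2⟩ := hb F hF hp T hT
    obtain ⟨_, h3⟩ := isPrefixMap_symbolMap hM p F hF hp T hT
    exact ⟨⟨_, h1⟩, Subtype.ext (h2.trans h3.symm), rfl⟩
  refine LinearMap.ext fun γ => ?_
  obtain ⟨γ', h, h'⟩ := hle ((dualFiltration_eq_prefixSpan hM p).le γ.2)
  obtain rfl : γ' = γ := Subtype.ext h'
  exact h

theorem isExactRow_symbolMap (hM : M.Loopless) (p : ℕ) : M.IsExactRow p (symbolMap hM p) :=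
  ⟨dualFiltration_anti (Nat.le_succ p), symbolMap_eq_zero_iff hM, symbolMap_surjective hM p⟩

/-- The diagram of a pair of loopless oriented matroids only requires an inclusion of topes: the
formula for `ã_p` does not mention the oriented matroid, and `𝒜_p(N') ⊆ 𝒜_p(N)` follows from
the surjectivity of `ã_p` for `N'`. -/
theorem filtrationDiagram_of_topes_subset {N' N : OrientedMatroid E} (hN' : N'.Loopless)
    (hN : N.Loopless) (h : N'.topes ⊆ N.topes) (p : ℕ) : FiltrationDiagram N' N p := by
  have hA : N'.dualCordovil p ≤ N.dualCordovil p := by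
    intro f hf
    obtain ⟨γ, hγ⟩ := symbolMap_surjective hN' p ⟨f, hf⟩
    have hfγ : (symbolMap hN p ⟨γ, dualFiltration_mono h p γ.2⟩ : SFSym E) = f := by
      rw [symbolMap_apply, ← symbolMap_apply hN', hγ]
    exact hfγ ▸ Subtype.coe_prop _
  refine ⟨dualFiltration_mono h, hA, symbolMap hN' p, symbolMap hN p,
    ⟨isPrefixMap_symbolMap hN' p, fun _ hb => hb.eq_symbolMap hN'⟩,
    ⟨isPrefixMap_symbolMap hN p, fun _ hb => hb.eq_symbolMap hN⟩,
    isExactRow_symbolMap hN' p, isExactRow_symbolMap hN p,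
    LinearMap.ext fun γ => Subtype.ext ?_⟩
  rw [LinearMap.comp_apply, LinearMap.comp_apply, Submodule.coe_inclusion, symbolMap_apply,
    symbolMap_apply, Submodule.coe_inclusion]

end Flags

end OrientedMatroid

theorem mainTheorem4 {E : Type*} [Fintype E] (M : OrientedMatroid E) (hM : M.Loopless) :
    (∀ F F' : M.FlatFlag, Set.range F.flat ⊆ Set.range F'.flat →
      ∀ p : ℕ, OrientedMatroid.FiltrationDiagram (M.initialAt F') (M.initialAt F) p) ∧
    (∀ F : M.FlatFlag,
      ∀ p : ℕ, OrientedMatroid.FiltrationDiagram (M.initialAt F) M p) := by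
  refine ⟨fun F F' h p => ?_, fun F p => ?_⟩
  · refine OrientedMatroid.filtrationDiagram_of_topes_subset
      (OrientedMatroid.loopless_initialAt F') (OrientedMatroid.loopless_initialAt F) ?_ p
    rw [OrientedMatroid.topes_initialAt hM, OrientedMatroid.topes_initialAt hM]
    exact OrientedMatroid.flagTopes_anti h
  · refine OrientedMatroid.filtrationDiagram_of_topes_subset
      (OrientedMatroid.loopless_initialAt F) hM ?_ p
    rw [OrientedMatroid.topes_initialAt hM]
    exact fun T hT => hT.1
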